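/- Let $(V_k)_{k\ge1}$ be independent, identically distributed real random variables with mean zero and finite variance $\sigma^2>0$. Let $\gamma_1,\gamma_2>0$ and $\alpha\in(0,1)$, and for $n\ge1$ put $k_n=n^\alpha$, $\theta_n=1+\gamma_1/k_n$ and $\rho_n=-1-\gamma_2/k_n$. For each $n\ge1$ define $X_{0,n}=\varepsilon_{0,n}=0$ and, for $k=1,\dots,n$, $$X_{k,n}=\theta_nX_{k-1,n}+\varepsilon_{k,n},\qquad \varepsilon_{k,n}=\rho_n\varepsilon_{k-1,n}+V_k,$$ and let $$\hat\theta_n=\frac{\sum_{k=1}^nX_{k,n}X_{k-1,n}}{\sum_{k=1}^nX_{k-1,n}^2}$$ be the least squares estimator of $\theta_n$ (with an arbitrary fixed convention, say $\hat\theta_n=0$, where the denominator vanishes). Let $C$ be a standard Cauchy random variable, i.e. one with density $x\mapsto\frac{1}{\pi(1+x^2)}$ on $\mathbb R$. Then, as $n\to\infty$: (1) if $\gamma_1>\gamma_2$, then $$\frac{1}{2\gamma_1}\sqrt{\frac{\gamma_2}{\gamma_1}}\;k_n\,\theta_n^{\,n}\rho_n^{-n}\,(\hat\theta_n-\theta_n)\longrightarrow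 C\quad\text{in distribution};$$ (2) if $\gamma_2>\gamma_1$, then $$\frac{1}{2\gamma_2}\sqrt{\frac{\gamma_1}{\gamma_2}}\;k_n\,\rho_n^{\,n}\theta_n^{-n}\,(\hat\theta_n-\rho_n)\longrightarrow C\quad\text{in distribution}.$$ -/

import Mathlib

open MeasureTheory ProbabilityTheory Filter

noncomputable section

/-- The rate `k_n = n ^ α`. -/
def rate (α : ℝ) (n : ℕ) : ℝ := (n : ℝ) ^ α

/-- The positive root `θ_n = 1 + γ₁ / k_n`. -/
def thetaRoot (α γ₁ : ℝ) (n : ℕ) : ℝ := 1 + γ₁ / rate α n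

/-- The negative root `ρ_n = -1 - γ₂ / k_n`. -/
def rhoRoot (α γ₂ : ℝ) (n : ℕ) : ℝ := -1 - γ₂ / rate α n

/-- The autoregressive errors `ε_k = ρ ε_{k-1} + V_k`, `k ≥ 1`, with `ε_0 = 0`.
The value `V 0` is never used. -/
def arError {Ω : Type*} (ρ : ℝ) (V : ℕ → Ω → ℝ) : ℕ → Ω → ℝ
  | 0, _ => 0
  | k + 1, ω => ρ * arError ρ V k ω + V (k + 1) ω

/-- The observations `X_k = θ X_{k-1} + ε_k`, `k ≥ 1`, with `X_0 = 0`. -/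
def arObs {Ω : Type*} (θ ρ : ℝ) (V : ℕ → Ω → ℝ) : ℕ → Ω → ℝ
  | 0, _ => 0
  | k + 1, ω => θ * arObs θ ρ V k ω + arError ρ V (k + 1) ω

/-- The least squares estimator
`(∑_{k=1}^n x_k x_{k-1}) / (∑_{k=1}^n x_{k-1}²)` computed from `x_0, …, x_n`. -/
def lsEstimator (x : ℕ → ℝ) (n : ℕ) : ℝ :=
  (∑ k ∈ Finset.Icc 1 n, x k * x (k - 1)) / ∑ k ∈ Finset.Icc 1 n, x (k - 1) ^ 2

/-- The least squares estimator `θ̂_n` in the `n`-th row of the model, whose coefficients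
are `θ_n` and `ρ_n`. -/
def thetaHat {Ω : Type*} (α γ₁ γ₂ : ℝ) (V : ℕ → Ω → ℝ) (n : ℕ) (ω : Ω) : ℝ :=
  lsEstimator (fun k => arObs (thetaRoot α γ₁ n) (rhoRoot α γ₂ n) V k ω) n

end

/-!
Write `A` and `B` for the first order autoregressions `A_k = θ A_{k-1} + V_k` and
`B_k = ρ B_{k-1} + V_k`; the latter is the error `ε`. By partial fractions
`(θ - ρ) X_k = A_{k+1} - B_{k+1}` (`sub_mul_arObs`), so that, where the denominator is nonzero,
`θ̂ - θ = (θ - ρ) (∑ B_k (A_k - B_k)) / ∑ (A_k - B_k)²` (`lsEstimator_sub`).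
This is symmetric in the two roots, so both assertions are one statement about a dominant root `l`
with `|l| = 1 + g / k_n` and another root `m` of opposite sign with `|m| = 1 + h / k_n`, `h < g`;
after division by the standard deviation the innovations have unit variance.

Let `a = ∑_{i ≤ n} l⁻ⁱ V_i` and `b = ∑_{i ≤ n} m⁻ⁱ V_i` (`discountedSum`). The state `A_k` is `lᵏ a`
up to a remainder that does not grow exponentially, and likewise for `B_k`. Hence, up to errors
small in `L¹`, the numerator is `a b ∑ (l m)ᵏ ≈ a b (l m)ⁿ / 2`, because `l m → -1`, and the
denominator is `a² ∑ l²ᵏ ≈ a² l²ⁿ k_n / (2 g)` (`lpBounded_numerator`, `lpBounded_denominator`).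
The errors are polynomial in `n` times `|m|⁻ⁿ` or `|m / l|ⁿ`, which decay like
`exp (-c n ^ (1 - α))` (`tendsto_sq_mul_div_pow`).

The weights of `a` and `b` are uniformly small after normalization, and asymptotically orthogonal
because `(l m)⁻ⁱ` alternates in sign. By a central limit theorem for weighted sums
(`tendstoInDistribution_weighted_pair`, a Lindeberg argument with characteristic functions) the
normalized pair `(a, b)` converges to a standard Gaussian pair. The normalized estimation error
behaves like the quotient `b / a`; the quotient of two independent standard Gaussians is standard
Cauchy (`map_div_gaussianReal_prod`), and `tendstoInDistribution_div` passes to the limit in the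
quotient. The event that the denominator of the estimator vanishes plays no role, since the limit
of the normalized denominator is almost surely nonzero.
-/

open scoped Topology ENNReal NNReal

/-! ### The ratio of two independent Gaussians -/

lemma lintegral_abs_mul_exp_neg_mul_sq {b : ℝ} (hb : 0 < b) :
    ∫⁻ x : ℝ, ENNReal.ofReal (|x| * Real.exp (-b * x ^ 2)) = ENNReal.ofReal (1 / b) := by
  rw [← ofReal_integral_eq_lintegral_ofReal]
  · congr 1
    have h1 : ∫ x : ℝ, |x| * Real.exp (-b * x ^ 2)
        = ∫ x : ℝ, (fun y => y * Real.exp (-b * y ^ 2)) |x| := by simp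
    rw [h1, integral_comp_abs (f := fun y => y * Real.exp (-b * y ^ 2))]
    have h2 := integral_rpow_mul_exp_neg_mul_rpow (p := 2) (q := 1) two_pos (by norm_num) hb
    norm_num at h2
    simp only [neg_mul]
    rw [h2, Real.rpow_neg_one]
    field_simp
  · refine (integrable_mul_exp_neg_mul_sq hb).abs.congr (ae_of_all _ fun x => ?_)
    simp [abs_mul]
  · exact ae_of_all _ fun x => by positivity

lemma gaussianReal_map_div_apply {x : ℝ} (hx : x ≠ 0) {B : Set ℝ} (hB : MeasurableSet B) :
    gaussianReal 0 1 ((fun y => y / x) ⁻¹' B)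
      = ∫⁻ t in B, ENNReal.ofReal ((√(2 * Real.pi))⁻¹ * |x| * Real.exp (-(x * t) ^ 2 / 2)) := by
  rw [← Measure.map_apply (by fun_prop) hB, gaussianReal_map_div_const, zero_div]
  have hv : (1 / NNReal.mk (x ^ 2) (sq_nonneg x) : ℝ≥0) ≠ 0 := by
    rw [← NNReal.coe_ne_zero]
    simpa using hx
  rw [gaussianReal_apply 0 hv]
  refine lintegral_congr fun t => ?_
  simp only [gaussianPDF, gaussianPDFReal]
  congr 1
  simp only [NNReal.coe_div, NNReal.coe_one, NNReal.coe_mk, sub_zero]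
  have h1 : 2 * Real.pi * (1 / x ^ 2) = 2 * Real.pi / x ^ 2 := by ring
  rw [h1, Real.sqrt_div (by positivity), Real.sqrt_sq_eq_abs, inv_div]
  congr 1
  · ring
  · congr 1
    field_simp

/-- The ratio of the coordinates of a standard Gaussian pair is standard Cauchy. -/
lemma map_div_gaussianReal_prod :
    ((gaussianReal 0 1).prod (gaussianReal 0 1)).map (fun p : ℝ × ℝ => p.2 / p.1)
      = cauchyMeasure 0 1 := by
  ext B hB
  have hm : Measurable fun p : ℝ × ℝ => p.2 / p.1 := by fun_prop
  rw [Measure.map_apply hm hB, Measure.prod_apply (hm hB)]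
  have hne : ∀ᵐ x ∂(gaussianReal 0 1), x ≠ 0 :=
    (gaussianReal_absolutelyContinuous 0 one_ne_zero).ae_le (Measure.ae_ne volume 0)
  have h1 : ∀ᵐ x ∂(gaussianReal 0 1),
      gaussianReal 0 1 (Prod.mk x ⁻¹' ((fun p : ℝ × ℝ => p.2 / p.1) ⁻¹' B))
        = ∫⁻ t in B, ENNReal.ofReal ((√(2 * Real.pi))⁻¹ * |x| * Real.exp (-(x * t) ^ 2 / 2)) := by
    filter_upwards [hne] with x hx using gaussianReal_map_div_apply hx hB
  rw [lintegral_congr_ae h1, lintegral_lintegral_swap (by fun_prop),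
    cauchyMeasure_of_scale_ne_zero 0 one_ne_zero, withDensity_apply _ hB]
  refine lintegral_congr fun t => ?_
  rw [gaussianReal_of_var_ne_zero 0 one_ne_zero,
    lintegral_withDensity_eq_lintegral_mul _ (measurable_gaussianPDF 0 1) (by fun_prop)]
  have hb : 0 < (1 + t ^ 2) / 2 := by positivity
  have h2 : ∀ x : ℝ, (gaussianPDF 0 1 * fun x =>
      ENNReal.ofReal ((√(2 * Real.pi))⁻¹ * |x| * Real.exp (-(x * t) ^ 2 / 2))) x
      = ENNReal.ofReal (2 * Real.pi)⁻¹
        * ENNReal.ofReal (|x| * Real.exp (-((1 + t ^ 2) / 2) * x ^ 2)) := by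
    intro x
    simp only [Pi.mul_apply, gaussianPDF, gaussianPDFReal]
    rw [← ENNReal.ofReal_mul (by positivity), ← ENNReal.ofReal_mul (by positivity)]
    congr 1
    have h3 : Real.exp (-((1 + t ^ 2) / 2) * x ^ 2)
        = Real.exp (-x ^ 2 / 2) * Real.exp (-(x * t) ^ 2 / 2) := by
      rw [← Real.exp_add]; congr 1; ring
    have h4 : (√(2 * Real.pi))⁻¹ * (√(2 * Real.pi))⁻¹ = (2 * Real.pi)⁻¹ := by
      rw [← mul_inv, Real.mul_self_sqrt (by positivity)]
    rw [h3, ← h4]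
    simp only [NNReal.coe_one, mul_one, sub_zero]
    ring
  rw [lintegral_congr h2, lintegral_const_mul _ (by fun_prop),
    lintegral_abs_mul_exp_neg_mul_sq hb, ← ENNReal.ofReal_mul (by positivity),
    cauchyPDF, cauchyPDFReal]
  congr 1
  simp only [NNReal.coe_one, sub_zero]
  field_simp
  ring

/-! ### A mapping theorem for quotients -/

/-- A mapping theorem for the quotient, whose discontinuity set `{p | p.2 = 0}` is not charged by
the limit. The quotients need only be correct where the denominator does not vanish. -/
lemma tendstoInDistribution_div {Ω Ω' Ω'' : Type*} [MeasurableSpace Ω] [MeasurableSpace Ω']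
    [MeasurableSpace Ω''] {P : Measure Ω} [IsProbabilityMeasure P] {P' : Measure Ω'}
    [IsProbabilityMeasure P'] {P'' : Measure Ω''} [IsProbabilityMeasure P'']
    {Z : ℕ → Ω → ℝ × ℝ} {W : Ω' → ℝ × ℝ}
    (h : TendstoInDistribution Z atTop W (fun _ => P) P') (hW : ∀ᵐ ω ∂P', (W ω).2 ≠ 0)
    {T : ℕ → Ω → ℝ} (hTm : ∀ n, AEMeasurable (T n) P)
    (hT : ∀ᶠ n in atTop, ∀ ω, (Z n ω).2 ≠ 0 → T n ω = (Z n ω).1 / (Z n ω).2)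
    {C : Ω'' → ℝ} (hCm : AEMeasurable C P'')
    (hC : P''.map C = P'.map (fun ω => (W ω).1 / (W ω).2)) :
    TendstoInDistribution T atTop C (fun _ => P) P'' where
  forall_aemeasurable := hTm
  aemeasurable_limit := hCm
  tendsto := by
    refine tendsto_of_forall_isOpen_le_liminf' fun G hG => ?_
    have hdiv : Measurable fun p : ℝ × ℝ => p.1 / p.2 := by fun_prop
    set O : Set (ℝ × ℝ) := {p | p.2 ≠ 0} ∩ (fun p : ℝ × ℝ => p.1 / p.2) ⁻¹' G with hO
    have hOo : IsOpen O := by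
      refine ContinuousOn.isOpen_inter_preimage ?_ ?_ hG
      · exact continuousOn_fst.div continuousOn_snd fun p hp => hp
      · exact isOpen_ne_fun continuous_snd continuous_const
    have key := ProbabilityMeasure.le_liminf_measure_open_of_tendsto h.tendsto hOo
    simp only [ProbabilityMeasure.coe_mk] at key ⊢
    have hWm := h.aemeasurable_limit
    have e1 : P''.map C G = P'.map W O := by
      rw [hC, Measure.map_apply_of_aemeasurable (f := fun ω => (W ω).1 / (W ω).2)
          (hdiv.comp_aemeasurable hWm) hG.measurableSet,
        Measure.map_apply_of_aemeasurable hWm hOo.measurableSet]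
      refine measure_congr ?_
      filter_upwards [hW] with ω hω
      exact propext ⟨fun h => ⟨hω, h⟩, fun h => h.2⟩
    rw [e1]
    refine key.trans (liminf_le_liminf ?_)
    filter_upwards [hT] with n hn
    rw [Measure.map_apply_of_aemeasurable (h.forall_aemeasurable n) hOo.measurableSet,
      Measure.map_apply_of_aemeasurable (hTm n) hG.measurableSet]
    refine measure_mono fun ω hω => ?_
    change T n ω ∈ G
    rw [hn ω hω.1]
    exact hω.2

/-! ### A central limit theorem for pairs of weighted sums -/

lemma norm_prod_sub_prod_le_sum {ι : Type*} (s : Finset ι) {f g : ι → ℂ}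
    (hf : ∀ i, ‖f i‖ ≤ 1) (hg : ∀ i, ‖g i‖ ≤ 1) :
    ‖∏ i ∈ s, f i - ∏ i ∈ s, g i‖ ≤ ∑ i ∈ s, ‖f i - g i‖ := by
  classical
  induction s using Finset.induction_on with
  | empty => simp
  | insert a s ha ih =>
    rw [Finset.prod_insert ha, Finset.prod_insert ha, Finset.sum_insert ha]
    have h1 : f a * ∏ i ∈ s, f i - g a * ∏ i ∈ s, g i
        = (f a - g a) * ∏ i ∈ s, f i + g a * (∏ i ∈ s, f i - ∏ i ∈ s, g i) := by ring
    rw [h1]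
    refine (norm_add_le _ _).trans ?_
    rw [norm_mul, norm_mul]
    have h2 : ‖∏ i ∈ s, f i‖ ≤ 1 := by
      rw [norm_prod]; exact Finset.prod_le_one (fun i _ => norm_nonneg _) fun i _ => hf i
    have h3 := norm_nonneg (f a - g a)
    have h4 := norm_nonneg (∏ i ∈ s, f i - ∏ i ∈ s, g i)
    nlinarith [hg a, norm_nonneg (g a)]

lemma isLittleO_cexp_neg_sq :
    (fun t : ℝ => Complex.exp (-(t : ℂ) ^ 2 / 2) - (1 - (t : ℂ) ^ 2 / 2))
      =o[𝓝 0] fun t : ℝ => t ^ 2 := by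
  -- This is the second order expansion of the characteristic function of `N(0, 1)`.
  have h := taylor_charFun_two (P := gaussianReal 0 1) (X := id) aemeasurable_id
    (by simp) (by
      have := variance_id_gaussianReal (μ := 0) (v := 1)
      rw [variance_eq_integral aemeasurable_id] at this
      simpa using this)
  simpa [charFun_gaussianReal, neg_div] using h

/-- The Lindeberg argument for weighted sums: the characteristic functions of `∑ wₙᵢ Vᵢ` converge to
that of a Gaussian as soon as the weights are uniformly small and `∑ wₙᵢ²` converges. -/
lemma tendsto_prod_comp_weights {φ : ℝ → ℂ} (hφ : ∀ t, ‖φ t‖ ≤ 1)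
    (hφ2 : (fun t : ℝ => φ t - (1 - (t : ℂ) ^ 2 / 2)) =o[𝓝 0] fun t : ℝ => t ^ 2)
    {w : ℕ → ℕ → ℝ} {δ : ℕ → ℝ} (hδ : Tendsto δ atTop (𝓝 0))
    (hw : ∀ᶠ n in atTop, ∀ i < n, |w n i| ≤ δ n) {τ : ℝ}
    (hs : Tendsto (fun n => ∑ i ∈ Finset.range n, w n i ^ 2) atTop (𝓝 τ)) :
    Tendsto (fun n => ∏ i ∈ Finset.range n, φ (w n i)) atTop (𝓝 (Complex.exp (-(τ : ℂ) / 2))) := by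
  set ψ : ℝ → ℂ := fun t => Complex.exp (-(t : ℂ) ^ 2 / 2) with hψ
  have hψ1 : ∀ t, ‖ψ t‖ ≤ 1 := fun t => by
    rw [hψ, Complex.norm_exp, ← Complex.ofReal_pow]
    have : (-((t ^ 2 : ℝ) : ℂ) / 2).re = -(t ^ 2) / 2 := by
      rw [← Complex.ofReal_neg, ← Complex.ofReal_ofNat, ← Complex.ofReal_div, Complex.ofReal_re]
    rw [this, Real.exp_le_one_iff]
    nlinarith [sq_nonneg t]
  have hO : (fun t : ℝ => φ t - ψ t) =o[𝓝 0] fun t : ℝ => t ^ 2 := by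
    refine (hφ2.sub isLittleO_cexp_neg_sq).congr_left fun t => ?_
    simp only [hψ]; ring
  have hlim : Tendsto (fun n => ∏ i ∈ Finset.range n, ψ (w n i)) atTop
      (𝓝 (Complex.exp (-(τ : ℂ) / 2))) := by
    have h1 : ∀ n, ∏ i ∈ Finset.range n, ψ (w n i)
        = Complex.exp (-((∑ i ∈ Finset.range n, w n i ^ 2 : ℝ) : ℂ) / 2) := fun n => by
      simp only [hψ]
      rw [← Complex.exp_sum]
      congr 1
      push_cast
      rw [neg_div, Finset.sum_div, ← Finset.sum_neg_distrib]
      exact Finset.sum_congr rfl fun i _ => by ring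
    simp_rw [h1]
    have h2 : Continuous fun x : ℝ => Complex.exp (-(x : ℂ) / 2) := by fun_prop
    exact (h2.tendsto τ).comp hs
  have hdiff : Tendsto (fun n => ∏ i ∈ Finset.range n, φ (w n i) - ∏ i ∈ Finset.range n, ψ (w n i))
      atTop (𝓝 0) := by
    rw [NormedAddGroup.tendsto_nhds_zero]
    intro ε hε
    have hK : 0 < |τ| + 1 := by positivity
    obtain ⟨d, hd, hball⟩ := Metric.eventually_nhds_iff.1
      (hO.def (show 0 < ε / 2 / (|τ| + 1) by positivity))
    filter_upwards [hw, hδ.eventually (gt_mem_nhds hd),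
      hs.eventually (gt_mem_nhds (show τ < |τ| + 1 by linarith [le_abs_self τ]))] with n h1 h2 h3
    have h4 : ∀ i ∈ Finset.range n,
        ‖φ (w n i) - ψ (w n i)‖ ≤ ε / 2 / (|τ| + 1) * w n i ^ 2 := fun i hi => by
      have := hball (y := w n i) (by
        simpa using (h1 i (Finset.mem_range.1 hi)).trans_lt h2)
      simpa using this
    calc _ ≤ ∑ i ∈ Finset.range n, ‖φ (w n i) - ψ (w n i)‖ :=
          norm_prod_sub_prod_le_sum _ (fun i => hφ _) fun i => hψ1 _
      _ ≤ ∑ i ∈ Finset.range n, ε / 2 / (|τ| + 1) * w n i ^ 2 := Finset.sum_le_sum h4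
      _ = ε / 2 / (|τ| + 1) * ∑ i ∈ Finset.range n, w n i ^ 2 := by rw [Finset.mul_sum]
      _ ≤ ε / 2 / (|τ| + 1) * (|τ| + 1) := by gcongr
      _ = ε / 2 := by field_simp
      _ < ε := by linarith
  simpa using hdiff.add hlim

/-- A central limit theorem for two weighted sums of the same i.i.d. sequence: if the two weight
vectors are asymptotically orthonormal and uniformly small, the limit is a standard Gaussian
pair. -/
lemma tendstoInDistribution_weighted_pair {Ω : Type*} [MeasurableSpace Ω] {P : Measure Ω}
    [IsProbabilityMeasure P] {U : ℕ → Ω → ℝ} (hindep : iIndepFun U P)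
    (hident : ∀ i, IdentDistrib (U i) (U 0) P P) (h0 : P[U 0] = 0) (h1 : P[U 0 ^ 2] = 1)
    {f g : ℕ → ℕ → ℝ} {δ : ℕ → ℝ} (hδ : Tendsto δ atTop (𝓝 0))
    (hf : ∀ᶠ n in atTop, ∀ i < n, |f n i| ≤ δ n) (hg : ∀ᶠ n in atTop, ∀ i < n, |g n i| ≤ δ n)
    (hff : Tendsto (fun n => ∑ i ∈ Finset.range n, f n i ^ 2) atTop (𝓝 1))
    (hgg : Tendsto (fun n => ∑ i ∈ Finset.range n, g n i ^ 2) atTop (𝓝 1))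
    (hfg : Tendsto (fun n => ∑ i ∈ Finset.range n, f n i * g n i) atTop (𝓝 0)) :
    TendstoInDistribution
      (fun n ω => (∑ i ∈ Finset.range n, f n i * U i ω, ∑ i ∈ Finset.range n, g n i * U i ω))
      atTop (id : ℝ × ℝ → ℝ × ℝ) (fun _ => P) ((gaussianReal 0 1).prod (gaussianReal 0 1)) := by
  have hU i := (hident i).aemeasurable_fst
  -- Lévy's theorem needs an inner product space, so the pair is viewed in `WithLp 2 (ℝ × ℝ)`.
  have key : TendstoInDistribution (fun n ω => WithLp.toLp 2
      (∑ i ∈ Finset.range n, f n i * U i ω, ∑ i ∈ Finset.range n, g n i * U i ω))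
      atTop (WithLp.toLp 2 : ℝ × ℝ → WithLp 2 (ℝ × ℝ)) (fun _ => P)
      ((gaussianReal 0 1).prod (gaussianReal 0 1)) := by
    have hX n : AEMeasurable (fun ω => ∑ i ∈ Finset.range n, f n i * U i ω) P :=
      Finset.aemeasurable_fun_sum _ fun i _ => (hU i).const_mul _
    have hY n : AEMeasurable (fun ω => ∑ i ∈ Finset.range n, g n i * U i ω) P :=
      Finset.aemeasurable_fun_sum _ fun i _ => (hU i).const_mul _
    refine ⟨fun n => (by fun_prop : Measurable (WithLp.toLp 2 : ℝ × ℝ → WithLp 2 (ℝ × ℝ))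
      ).comp_aemeasurable ((hX n).prodMk (hY n)), by fun_prop, ?_⟩
    refine ProbabilityMeasure.tendsto_of_tendsto_charFun fun t => ?_
    simp only [ProbabilityMeasure.coe_mk]
    obtain ⟨u, v⟩ := t
    rw [charFun_prod]
    set φ := charFun (P.map (U 0)) with hφ
    have e1 : ∀ n, charFun (P.map (fun ω => WithLp.toLp 2
        (∑ i ∈ Finset.range n, f n i * U i ω, ∑ i ∈ Finset.range n, g n i * U i ω)))
          (WithLp.toLp 2 (u, v)) = ∏ i ∈ Finset.range n, φ (u * f n i + v * g n i) := by
      intro n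
      set c : ℕ → ℝ := fun i => u * f n i + v * g n i with hc
      have hind : iIndepFun (fun i ω => c i * U i ω) P :=
        hindep.comp (fun i x => c i * x) fun i => by fun_prop
      have h2 : charFun (P.map (fun ω => ∑ i ∈ Finset.range n, c i * U i ω)) 1
          = ∏ i ∈ Finset.range n, φ (c i) := by
        rw [iIndepFun.charFun_map_fun_finsetSum_eq_prod (X := fun i ω => c i * U i ω)
          (fun i _ => (hU i).const_mul _) (hind.restrict _), Finset.prod_apply]
        refine Finset.prod_congr rfl fun i _ => ?_
        rw [charFun_map_mul_comp (hU i), (hident i).map_eq, mul_one]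
      rw [← h2, charFun_apply, charFun_apply, integral_map, integral_map]
      · refine integral_congr_ae (ae_of_all _ fun ω => ?_)
        simp only [WithLp.prod_inner_apply, hc]
        simp only [RCLike.inner_apply, conj_trivial, one_mul, add_mul, Finset.sum_add_distrib,
          Finset.mul_sum, mul_assoc]
      · exact Finset.aemeasurable_fun_sum _ fun i _ => (hU i).const_mul _
      · fun_prop
      · exact (by fun_prop : Measurable (WithLp.toLp 2 : ℝ × ℝ → WithLp 2 (ℝ × ℝ))
          ).comp_aemeasurable ((hX n).prodMk (hY n))
      · fun_prop
    simp_rw [e1]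
    have hprob : IsProbabilityMeasure (P.map (U 0)) := Measure.isProbabilityMeasure_map (hU 0)
    have hlim := tendsto_prod_comp_weights (φ := φ) (fun t => norm_charFun_le_one t)
      (taylor_charFun_two (hU 0) h0 h1) (w := fun n i => u * f n i + v * g n i)
      (δ := fun n => (|u| + |v|) * δ n) (by simpa using hδ.const_mul (|u| + |v|)) (by
        filter_upwards [hf, hg] with n hfn hgn i hi
        calc |u * f n i + v * g n i| ≤ |u| * |f n i| + |v| * |g n i| := by
              rw [← abs_mul, ← abs_mul]; exact abs_add_le _ _
          _ ≤ |u| * δ n + |v| * δ n := by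
              gcongr
              · exact hfn i hi
              · exact hgn i hi
          _ = (|u| + |v|) * δ n := by ring) (τ := u ^ 2 + v ^ 2) (by
        have := ((hff.const_mul (u ^ 2)).add (hfg.const_mul (2 * u * v))).add
          (hgg.const_mul (v ^ 2))
        simp only [mul_one, mul_zero, add_zero] at this
        refine this.congr fun n => ?_
        rw [Finset.mul_sum, Finset.mul_sum, Finset.mul_sum, ← Finset.sum_add_distrib,
          ← Finset.sum_add_distrib]
        exact Finset.sum_congr rfl fun i _ => by ring)
    convert! hlim using 2
    rw [charFun_gaussianReal, charFun_gaussianReal, ← Complex.exp_add]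
    congr 1
    simp
    ring
  exact key.continuous_comp (g := WithLp.ofLp) (by fun_prop)

/-! ### Partial fractions for the autoregression -/

/-- The discounted sum `∑_{i=1}^n r⁻ⁱ V_i`, i.e. the state `arError r V n` divided by `r ^ n`. -/
noncomputable def discountedSum {Ω : Type*} (r : ℝ) (V : ℕ → Ω → ℝ) (n : ℕ) (ω : Ω) : ℝ :=
  ∑ i ∈ Finset.range n, r⁻¹ ^ (i + 1) * V (i + 1) ω

lemma arError_eq_pow_mul_discountedSum {Ω : Type*} {r : ℝ} (hr : r ≠ 0) (V : ℕ → Ω → ℝ) (k : ℕ)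
    (ω : Ω) : arError r V k ω = r ^ k * discountedSum r V k ω := by
  induction k with
  | zero => simp [arError, discountedSum]
  | succ k ih =>
    rw [arError, ih]
    have h1 : r ^ (k + 1) * r⁻¹ ^ (k + 1) = 1 := by rw [← mul_pow, mul_inv_cancel₀ hr, one_pow]
    rw [discountedSum, discountedSum, Finset.sum_range_succ, mul_add, ← mul_assoc (r ^ (k + 1)), h1]
    ring

lemma arError_eq_sum {Ω : Type*} {r : ℝ} (hr : r ≠ 0) (V : ℕ → Ω → ℝ) (k : ℕ) (ω : Ω) :
    arError r V k ω = ∑ i ∈ Finset.range k, (r ^ k * r⁻¹ ^ (i + 1)) * V (i + 1) ω := by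
  rw [arError_eq_pow_mul_discountedSum hr, discountedSum, Finset.mul_sum]
  exact Finset.sum_congr rfl fun i _ => by ring

lemma pow_mul_discountedSum_sub_arError {Ω : Type*} {r : ℝ} (hr : r ≠ 0) (V : ℕ → Ω → ℝ)
    {k n : ℕ} (hkn : k ≤ n) (ω : Ω) :
    r ^ k * discountedSum r V n ω - arError r V k ω
      = ∑ i ∈ Finset.Ico k n, (r ^ k * r⁻¹ ^ (i + 1)) * V (i + 1) ω := by
  rw [arError_eq_sum hr, Finset.sum_Ico_eq_sub _ hkn, discountedSum, Finset.mul_sum]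
  congr 1
  exact Finset.sum_congr rfl fun i _ => by ring

/-- Partial fractions: the second order autoregression with roots `l` and `m` is a combination of
the two first order autoregressions with these roots. -/
lemma sub_mul_arObs {Ω : Type*} (l m : ℝ) (V : ℕ → Ω → ℝ) (k : ℕ) (ω : Ω) :
    (l - m) * arObs l m V k ω = arError l V (k + 1) ω - arError m V (k + 1) ω := by
  induction k with
  | zero => simp [arObs, arError]
  | succ k ih =>
    have h1 : (l - m) * arObs l m V (k + 1) ω
        = l * ((l - m) * arObs l m V k ω) + (l - m) * arError m V (k + 1) ω := by
      rw [arObs]; ring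
    have h2 : ∀ r, arError r V (k + 1 + 1) ω = r * arError r V (k + 1) ω + V (k + 1 + 1) ω :=
      fun r => rfl
    rw [h1, ih, h2, h2]
    ring

lemma arObs_comm {Ω : Type*} {l m : ℝ} (h : l ≠ m) (V : ℕ → Ω → ℝ) (k : ℕ) (ω : Ω) :
    arObs l m V k ω = arObs m l V k ω := by
  have h1 := sub_mul_arObs l m V k ω
  have h2 := sub_mul_arObs m l V k ω
  refine mul_left_cancel₀ (sub_ne_zero.2 h) ?_
  linarith

lemma lsEstimator_sub {Ω : Type*} {l m : ℝ} (h : l ≠ m) (V : ℕ → Ω → ℝ) (n : ℕ) (ω : Ω)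
    (hD : ∑ k ∈ Finset.Icc 1 n, (arError l V k ω - arError m V k ω) ^ 2 ≠ 0) :
    lsEstimator (fun k => arObs l m V k ω) n - l
      = (l - m) * (∑ k ∈ Finset.Icc 1 n,
            arError m V k ω * (arError l V k ω - arError m V k ω))
          / ∑ k ∈ Finset.Icc 1 n, (arError l V k ω - arError m V k ω) ^ 2 := by
  have hlm := sub_ne_zero.2 h
  have e1 : ∑ k ∈ Finset.Icc 1 n, (arError l V k ω - arError m V k ω) ^ 2
      = (l - m) ^ 2 * ∑ k ∈ Finset.Icc 1 n, arObs l m V (k - 1) ω ^ 2 := by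
    rw [Finset.mul_sum]
    refine Finset.sum_congr rfl fun k hk => ?_
    obtain ⟨j, rfl⟩ := Nat.exists_eq_add_of_le' (Finset.mem_Icc.1 hk).1
    rw [← sub_mul_arObs, Nat.add_sub_cancel]
    ring
  have e2 : ∑ k ∈ Finset.Icc 1 n, arError m V k ω * (arError l V k ω - arError m V k ω)
      = (l - m) * (∑ k ∈ Finset.Icc 1 n, arObs l m V k ω * arObs l m V (k - 1) ω
        - l * ∑ k ∈ Finset.Icc 1 n, arObs l m V (k - 1) ω ^ 2) := by
    rw [Finset.mul_sum, ← Finset.sum_sub_distrib, Finset.mul_sum]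
    refine Finset.sum_congr rfl fun k hk => ?_
    obtain ⟨j, rfl⟩ := Nat.exists_eq_add_of_le' (Finset.mem_Icc.1 hk).1
    rw [← sub_mul_arObs, Nat.add_sub_cancel, arObs]
    ring
  rw [e1] at hD
  have hS := right_ne_zero_of_mul hD
  rw [e1, e2, lsEstimator]
  field_simp

lemma arError_const_mul {Ω : Type*} (c r : ℝ) (V : ℕ → Ω → ℝ) (k : ℕ) (ω : Ω) :
    arError r (fun i ω => c * V i ω) k ω = c * arError r V k ω := by
  induction k with
  | zero => simp [arError]
  | succ k ih => rw [arError, ih, arError]; ring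

lemma arObs_const_mul {Ω : Type*} (c l m : ℝ) (V : ℕ → Ω → ℝ) (k : ℕ) (ω : Ω) :
    arObs l m (fun i ω => c * V i ω) k ω = c * arObs l m V k ω := by
  induction k with
  | zero => simp [arObs]
  | succ k ih => rw [arObs, ih, arObs, arError_const_mul]; ring

lemma lsEstimator_const_mul {c : ℝ} (hc : c ≠ 0) (x : ℕ → ℝ) (n : ℕ) :
    lsEstimator (fun k => c * x k) n = lsEstimator x n := by
  have e1 : ∑ k ∈ Finset.Icc 1 n, c * x k * (c * x (k - 1))
      = c ^ 2 * ∑ k ∈ Finset.Icc 1 n, x k * x (k - 1) := by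
    rw [Finset.mul_sum]; exact Finset.sum_congr rfl fun k _ => by ring
  have e2 : ∑ k ∈ Finset.Icc 1 n, (c * x (k - 1)) ^ 2
      = c ^ 2 * ∑ k ∈ Finset.Icc 1 n, x (k - 1) ^ 2 := by
    rw [Finset.mul_sum]; exact Finset.sum_congr rfl fun k _ => by ring
  rw [lsEstimator, lsEstimator, e1, e2, mul_div_mul_left _ _ (pow_ne_zero 2 hc)]

/-! ### Quantitative bounds in L^p -/

/-- The random variable `f` lies in `L^p`, with norm at most the real number `c ≥ 0`. -/
structure LpBounded {Ω : Type*} [MeasurableSpace Ω] (P : Measure Ω) (p : ℝ≥0∞) (f : Ω → ℝ)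
    (c : ℝ) : Prop where
  nonneg : 0 ≤ c
  memLp : MemLp f p P
  le : eLpNorm f p P ≤ ENNReal.ofReal c

namespace LpBounded

variable {Ω : Type*} [MeasurableSpace Ω] {P : Measure Ω} {p : ℝ≥0∞} {f g : Ω → ℝ} {c d : ℝ}

lemma mono (hf : LpBounded P p f c) (h : c ≤ d) : LpBounded P p f d :=
  ⟨hf.nonneg.trans h, hf.memLp, hf.le.trans (ENNReal.ofReal_le_ofReal h)⟩

lemma zero : LpBounded P p (fun _ => 0) 0 :=
  ⟨le_rfl, MemLp.zero', by simp⟩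

lemma add (hp : 1 ≤ p) (hf : LpBounded P p f c) (hg : LpBounded P p g d) :
    LpBounded P p (fun ω => f ω + g ω) (c + d) :=
  ⟨add_nonneg hf.nonneg hg.nonneg, hf.memLp.add hg.memLp, by
    rw [ENNReal.ofReal_add hf.nonneg hg.nonneg]
    exact (eLpNorm_add_le hf.memLp.1 hg.memLp.1 hp).trans (add_le_add hf.le hg.le)⟩

lemma const_mul (hf : LpBounded P p f c) (r : ℝ) : LpBounded P p (fun ω => r * f ω) (|r| * c) :=
  ⟨mul_nonneg (abs_nonneg r) hf.nonneg, hf.memLp.const_mul r, by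
    have : (fun ω => r * f ω) = r • f := rfl
    rw [this, eLpNorm_const_smul, ENNReal.ofReal_mul (abs_nonneg r), Real.enorm_eq_ofReal_abs]
    gcongr
    exact hf.le⟩

lemma neg (hf : LpBounded P p f c) : LpBounded P p (fun ω => -f ω) c := by
  simpa using hf.const_mul (-1)

lemma sub (hp : 1 ≤ p) (hf : LpBounded P p f c) (hg : LpBounded P p g d) :
    LpBounded P p (fun ω => f ω - g ω) (c + d) := by
  simpa [sub_eq_add_neg] using hf.add hp hg.neg

lemma mul (hf : LpBounded P 2 f c) (hg : LpBounded P 2 g d) :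
    LpBounded P 1 (fun ω => f ω * g ω) (c * d) := by
  refine ⟨mul_nonneg hf.nonneg hg.nonneg, ?_, ?_⟩
  · exact memLp_one_iff_integrable.2 (hf.memLp.integrable_mul hg.memLp)
  · rw [ENNReal.ofReal_mul hf.nonneg]
    exact (eLpNorm_smul_le_mul_eLpNorm (p := 2) (q := 2) (r := 1) hg.memLp.1 hf.memLp.1).trans
      (mul_le_mul' hf.le hg.le)

lemma sum (hp : 1 ≤ p) {s : Finset ℕ} {F : ℕ → Ω → ℝ} (hF : ∀ k ∈ s, LpBounded P p (F k) c) :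
    LpBounded P p (fun ω => ∑ k ∈ s, F k ω) (s.card * c) := by
  classical
  induction s using Finset.induction_on with
  | empty => simpa using zero
  | insert a s ha ih =>
    have h := (hF a (Finset.mem_insert_self a s)).add hp
      (ih fun k hk => hF k (Finset.mem_insert_of_mem hk))
    simp only [Finset.sum_insert ha, Finset.card_insert_of_notMem ha]
    exact h.mono (le_of_eq (by push_cast; ring))

end LpBounded

lemma lpBounded_weighted_sum {Ω : Type*} [MeasurableSpace Ω] {P : Measure Ω}
    [IsProbabilityMeasure P] {U : ℕ → Ω → ℝ} (hindep : iIndepFun U P)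
    (hident : ∀ i, IdentDistrib (U i) (U 0) P P) (hL2 : MemLp (U 0) 2 P) (h0 : P[U 0] = 0)
    (h1 : P[U 0 ^ 2] = 1) (c : ℕ → ℝ) (s : Finset ℕ) :
    LpBounded P 2 (fun ω => ∑ i ∈ s, c i * U i ω) (√(∑ i ∈ s, c i ^ 2)) := by
  have hUL i : MemLp (U i) 2 P := (hident i).memLp_iff.2 hL2
  have hL i : MemLp (fun ω => c i * U i ω) 2 P := (hUL i).const_mul (c i)
  have hS : MemLp (fun ω => ∑ i ∈ s, c i * U i ω) 2 P := memLp_finsetSum s fun i _ => hL i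
  have hind : iIndepFun (fun i ω => c i * U i ω) P :=
    hindep.comp (fun i x => c i * x) fun i => by fun_prop
  have hmean : ∫ ω, ∑ i ∈ s, c i * U i ω ∂P = 0 := by
    rw [integral_finsetSum s fun i _ => (hL i).integrable one_le_two]
    refine Finset.sum_eq_zero fun i _ => ?_
    rw [integral_const_mul, (hident i).integral_eq, h0, mul_zero]
  have hv0 : variance (U 0) P = 1 := by
    rw [variance_eq_sub hL2, h0, h1]; norm_num
  have hvar : ∫ ω, (∑ i ∈ s, c i * U i ω) ^ 2 ∂P = ∑ i ∈ s, c i ^ 2 := by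
    have h2 := IndepFun.variance_sum (s := s) (X := fun i ω => c i * U i ω) (fun i _ => hL i)
      fun i _ j _ hij => hind.indepFun hij
    have h3 : (∑ i ∈ s, fun ω => c i * U i ω) = fun ω => ∑ i ∈ s, c i * U i ω := by
      ext ω; simp
    rw [h3, variance_of_integral_eq_zero hS.aemeasurable hmean] at h2
    rw [h2]
    refine Finset.sum_congr rfl fun i _ => ?_
    rw [variance_const_mul, (hident i).variance_eq, hv0, mul_one]
  refine ⟨Real.sqrt_nonneg _, hS, ?_⟩
  rw [hS.eLpNorm_eq_integral_rpow_norm two_ne_zero ENNReal.ofNat_ne_top]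
  apply le_of_eq
  congr 1
  rw [← hvar, Real.sqrt_eq_rpow]
  norm_num

/-! ### Replacing the states by the terminal discounted sums -/

section Moments

variable {Ω : Type*} [MeasurableSpace Ω] {P : Measure Ω} {V : ℕ → Ω → ℝ}

lemma lpBounded_weighted_sum_of_abs_le
    (hV : ∀ (c : ℕ → ℝ) (s : Finset ℕ),
      LpBounded P 2 (fun ω => ∑ i ∈ s, c i * V (i + 1) ω) (√(∑ i ∈ s, c i ^ 2)))
    {c : ℕ → ℝ} {s : Finset ℕ} {n : ℕ} (hs : s.card ≤ n) {K : ℝ} (hK : 0 ≤ K)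
    (hc : ∀ i ∈ s, |c i| ≤ K) :
    LpBounded P 2 (fun ω => ∑ i ∈ s, c i * V (i + 1) ω) (√n * K) := by
  refine (hV c s).mono ?_
  have h1 : ∑ i ∈ s, c i ^ 2 ≤ n * K ^ 2 := by
    calc ∑ i ∈ s, c i ^ 2 ≤ ∑ i ∈ s, K ^ 2 := Finset.sum_le_sum fun i hi => by
          rw [← sq_abs]; exact pow_le_pow_left₀ (abs_nonneg _) (hc i hi) 2
      _ = s.card * K ^ 2 := by simp
      _ ≤ n * K ^ 2 := by gcongr
  calc √(∑ i ∈ s, c i ^ 2) ≤ √(n * K ^ 2) := Real.sqrt_le_sqrt h1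
    _ = √n * K := by rw [Real.sqrt_mul (Nat.cast_nonneg n), Real.sqrt_sq hK]

variable (hV : ∀ (c : ℕ → ℝ) (s : Finset ℕ),
  LpBounded P 2 (fun ω => ∑ i ∈ s, c i * V (i + 1) ω) (√(∑ i ∈ s, c i ^ 2)))

include hV

lemma lpBounded_discountedSum {r : ℝ} (hr : 1 ≤ |r|) (n : ℕ) :
    LpBounded P 2 (discountedSum r V n) √n := by
  have h := lpBounded_weighted_sum_of_abs_le hV (c := fun i => r⁻¹ ^ (i + 1))
    (s := Finset.range n) (n := n) (by simp) zero_le_one fun i _ => by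
      rw [abs_pow, abs_inv]; exact pow_le_one₀ (by positivity) (inv_le_one_of_one_le₀ hr)
  rwa [mul_one] at h

lemma lpBounded_arError {r : ℝ} (hr : 1 ≤ |r|) {k n : ℕ} (hkn : k ≤ n) :
    LpBounded P 2 (arError r V k) (√n * |r| ^ n) := by
  have hr0 : r ≠ 0 := by rintro rfl; norm_num at hr
  have h := lpBounded_weighted_sum_of_abs_le hV (c := fun i => r ^ k * r⁻¹ ^ (i + 1))
    (s := Finset.range k) (n := n) (by simpa using hkn) (K := |r| ^ n) (by positivity)
    fun i _ => by
      rw [abs_mul, abs_pow, abs_pow, abs_inv]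
      calc |r| ^ k * |r|⁻¹ ^ (i + 1) ≤ |r| ^ n * 1 := by
            gcongr
            exact pow_le_one₀ (by positivity) (inv_le_one_of_one_le₀ hr)
        _ = |r| ^ n := mul_one _
  have e : (fun ω => ∑ i ∈ Finset.range k, (r ^ k * r⁻¹ ^ (i + 1)) * V (i + 1) ω)
      = arError r V k := by
    ext ω; rw [arError_eq_sum hr0]
  rwa [e] at h

lemma lpBounded_pow_mul_discountedSum {r : ℝ} (hr : 1 ≤ |r|) {k n : ℕ} (hkn : k ≤ n) :
    LpBounded P 2 (fun ω => r ^ k * discountedSum r V n ω) (|r| ^ n * √n) := by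
  refine ((lpBounded_discountedSum hV hr n).const_mul (r ^ k)).mono ?_
  rw [abs_pow]
  gcongr

/-- The innovations after time `k` contribute to `r ^ k * discountedSum r V n` only a remainder
without exponential growth. -/
lemma lpBounded_remainder {r : ℝ} (hr : 1 ≤ |r|) {k n : ℕ} (hkn : k ≤ n) :
    LpBounded P 2 (fun ω => r ^ k * discountedSum r V n ω - arError r V k ω) √n := by
  have hr0 : r ≠ 0 := by rintro rfl; norm_num at hr
  have h := lpBounded_weighted_sum_of_abs_le hV (c := fun i => r ^ k * r⁻¹ ^ (i + 1))
    (s := Finset.Ico k n) (n := n) (by simp) (K := 1) zero_le_one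
    fun i hi => by
      have hki : k ≤ i + 1 := (Finset.mem_Ico.1 hi).1.trans (Nat.le_succ i)
      rw [abs_mul, abs_pow, abs_pow, abs_inv]
      calc |r| ^ k * |r|⁻¹ ^ (i + 1) ≤ |r| ^ (i + 1) * |r|⁻¹ ^ (i + 1) := by
            gcongr
        _ = 1 := by rw [← mul_pow, mul_inv_cancel₀ (by positivity), one_pow]
  simp_rw [pow_mul_discountedSum_sub_arError hr0 V hkn]
  rwa [mul_one] at h

/-- The numerator of the estimation error is governed by the terminal discounted sums. -/
lemma lpBounded_numerator {l m : ℝ} (hm : 1 ≤ |m|) (hml : |m| ≤ |l|) (n : ℕ) :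
    LpBounded P 1 (fun ω =>
      ∑ k ∈ Finset.Icc 1 n, arError m V k ω * (arError l V k ω - arError m V k ω)
        - (∑ k ∈ Finset.Icc 1 n, (l * m) ^ k) * (discountedSum l V n ω * discountedSum m V n ω))
      ((n : ℝ) ^ 2 * (3 * |l| ^ n + (|m| ^ n) ^ 2)) := by
  have hl := hm.trans hml
  have hsq : √(n : ℝ) * √n = n := Real.mul_self_sqrt (Nat.cast_nonneg n)
  have h1m : 1 ≤ |m| ^ n := one_le_pow₀ hm
  have h1l : 1 ≤ |l| ^ n := one_le_pow₀ hl
  have hmln : |m| ^ n ≤ |l| ^ n := pow_le_pow_left₀ (abs_nonneg m) hml n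
  have key : ∀ k ∈ Finset.Icc 1 n, LpBounded P 1 (fun ω =>
      arError m V k ω * (arError l V k ω - arError m V k ω)
        - (l * m) ^ k * (discountedSum l V n ω * discountedSum m V n ω))
      (n * (3 * |l| ^ n + (|m| ^ n) ^ 2)) := by
    intro k hk
    have hkn := (Finset.mem_Icc.1 hk).2
    have hu := lpBounded_pow_mul_discountedSum hV hl hkn
    have hv := lpBounded_pow_mul_discountedSum hV hm hkn
    have hr := lpBounded_remainder hV hl hkn
    have hq := lpBounded_remainder hV hm hkn
    have hB := lpBounded_arError hV hm hkn
    -- With `A = u - r` and `B = v - q`: `B (A - B) - u v = r q - u q - r v - B²`.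
    have h := (((hr.mul hq).sub le_rfl (hu.mul hq)).sub le_rfl (hr.mul hv)).sub le_rfl (hB.mul hB)
    have e : ∀ ω, arError m V k ω * (arError l V k ω - arError m V k ω)
        - (l * m) ^ k * (discountedSum l V n ω * discountedSum m V n ω)
        = (l ^ k * discountedSum l V n ω - arError l V k ω)
            * (m ^ k * discountedSum m V n ω - arError m V k ω)
          - l ^ k * discountedSum l V n ω * (m ^ k * discountedSum m V n ω - arError m V k ω)
          - (l ^ k * discountedSum l V n ω - arError l V k ω) * (m ^ k * discountedSum m V n ω)
          - arError m V k ω * arError m V k ω := fun ω => by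
      rw [mul_pow]; ring
    simp_rw [e]
    refine h.mono ?_
    calc √(n : ℝ) * √n + |l| ^ n * √n * √n + √n * (|m| ^ n * √n) + √n * |m| ^ n * (√n * |m| ^ n)
        = (√(n : ℝ) * √n) * (1 + |l| ^ n + |m| ^ n + (|m| ^ n) ^ 2) := by ring
      _ ≤ n * (3 * |l| ^ n + (|m| ^ n) ^ 2) := by
        rw [hsq]; gcongr; linarith
  have h := LpBounded.sum le_rfl key
  simp only [Finset.sum_sub_distrib, ← Finset.sum_mul] at h
  exact h.mono (le_of_eq (by simp; ring))

/-- The denominator of the estimation error is governed by the dominant discounted sum. -/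
lemma lpBounded_denominator {l m : ℝ} (hm : 1 ≤ |m|) (hml : |m| ≤ |l|) (n : ℕ) :
    LpBounded P 1 (fun ω =>
      ∑ k ∈ Finset.Icc 1 n, (arError l V k ω - arError m V k ω) ^ 2
        - (∑ k ∈ Finset.Icc 1 n, (l ^ 2) ^ k) * discountedSum l V n ω ^ 2)
      ((n : ℝ) ^ 2 * (8 * (|l| ^ n * |m| ^ n))) := by
  have hl := hm.trans hml
  have hsq : √(n : ℝ) * √n = n := Real.mul_self_sqrt (Nat.cast_nonneg n)
  have h1m : 1 ≤ |m| ^ n := one_le_pow₀ hm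
  have h1l : 1 ≤ |l| ^ n := one_le_pow₀ hl
  have hmln : |m| ^ n ≤ |l| ^ n := pow_le_pow_left₀ (abs_nonneg m) hml n
  have key : ∀ k ∈ Finset.Icc 1 n, LpBounded P 1 (fun ω =>
      (arError l V k ω - arError m V k ω) ^ 2 - (l ^ 2) ^ k * discountedSum l V n ω ^ 2)
      (n * (8 * (|l| ^ n * |m| ^ n))) := by
    intro k hk
    have hkn := (Finset.mem_Icc.1 hk).2
    have hu := lpBounded_pow_mul_discountedSum hV hl hkn
    have hr := lpBounded_remainder hV hl hkn
    have hB := lpBounded_arError hV hm hkn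
    have he : LpBounded P 2 (fun ω => l ^ k * discountedSum l V n ω - arError l V k ω
        + arError m V k ω) (2 * √n * |m| ^ n) :=
      (hr.add one_le_two hB).mono (by nlinarith [Real.sqrt_nonneg (n : ℝ)])
    -- With `A - B = u - e`: `(A - B)² - u² = e² - 2 u e`.
    have h := (he.mul he).sub le_rfl ((hu.mul he).const_mul 2)
    have e : ∀ ω, (arError l V k ω - arError m V k ω) ^ 2
        - (l ^ 2) ^ k * discountedSum l V n ω ^ 2
        = (l ^ k * discountedSum l V n ω - arError l V k ω + arError m V k ω)
            * (l ^ k * discountedSum l V n ω - arError l V k ω + arError m V k ω)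
          - 2 * (l ^ k * discountedSum l V n ω
            * (l ^ k * discountedSum l V n ω - arError l V k ω + arError m V k ω)) := fun ω => by
      rw [← pow_mul, mul_comm 2 k, pow_mul]; ring
    simp_rw [e]
    refine h.mono ?_
    calc 2 * √(n : ℝ) * |m| ^ n * (2 * √n * |m| ^ n)
          + |2| * (|l| ^ n * √n * (2 * √n * |m| ^ n))
        = (√(n : ℝ) * √n) * (4 * (|m| ^ n * |m| ^ n) + 4 * (|l| ^ n * |m| ^ n)) := by
          rw [abs_two]; ring
      _ ≤ n * (8 * (|l| ^ n * |m| ^ n)) := by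
        rw [hsq]
        gcongr
        nlinarith
  have h := LpBounded.sum le_rfl key
  simp only [Finset.sum_sub_distrib, ← Finset.sum_mul] at h
  exact h.mono (le_of_eq (by simp; ring))

end Moments

/-! ### Growth rates and geometric sums -/

section Asymptotics

lemma rate_nonneg (α : ℝ) (n : ℕ) : 0 ≤ rate α n := Real.rpow_nonneg (Nat.cast_nonneg n) α

lemma tendsto_rate {α : ℝ} (hα : 0 < α) : Tendsto (rate α) atTop atTop :=
  (tendsto_rpow_atTop hα).comp tendsto_natCast_atTop_atTop

lemma tendsto_const_div_rate {α : ℝ} (hα : 0 < α) (g : ℝ) :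
    Tendsto (fun n => g / rate α n) atTop (𝓝 0) := (tendsto_rate hα).const_div_atTop g

lemma tendsto_one_add_div_rate {α : ℝ} (hα : 0 < α) (g : ℝ) :
    Tendsto (fun n => 1 + g / rate α n) atTop (𝓝 1) := by
  simpa using (tendsto_const_div_rate hα g).const_add 1

lemma one_le_one_add_div_rate (α : ℝ) {g : ℝ} (hg : 0 ≤ g) (n : ℕ) : 1 ≤ 1 + g / rate α n := by
  have := div_nonneg hg (rate_nonneg α n)
  linarith

/-- Since `n / n ^ α = n ^ (1 - α) → ∞`, powers of `1 - c / n ^ α` beat polynomials. -/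
lemma tendsto_sq_mul_pow_of_le {α : ℝ} (hα : α ∈ Set.Ioo (0 : ℝ) 1) {c : ℝ} (hc : 0 < c)
    {r : ℕ → ℝ} (hr0 : ∀ᶠ n in atTop, 0 ≤ r n)
    (hr : ∀ᶠ n in atTop, r n ≤ 1 - c / rate α n) :
    Tendsto (fun n : ℕ => (n : ℝ) ^ 2 * r n ^ n) atTop (𝓝 0) := by
  have h1α : 0 < 1 - α := sub_pos.2 hα.2
  have hlim := (tendsto_rpow_mul_exp_neg_mul_atTop_nhds_zero (2 / (1 - α)) c hc).comp
    ((tendsto_rpow_atTop h1α).comp tendsto_natCast_atTop_atTop)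
  refine squeeze_zero' ?_ ?_ hlim
  · filter_upwards [hr0] with n hn
    positivity
  · filter_upwards [hr0, hr, eventually_gt_atTop 0] with n h0 h1 hn
    have hnR : (0 : ℝ) < n := Nat.cast_pos.2 hn
    have e1 : ((n : ℝ) ^ (1 - α)) ^ (2 / (1 - α)) = (n : ℝ) ^ 2 := by
      rw [← Real.rpow_mul hnR.le, mul_div_cancel₀ _ h1α.ne']
      norm_num
    have e2 : -c * (n : ℝ) ^ (1 - α) = n * (-(c / rate α n)) := by
      rw [rate, Real.rpow_sub hnR, Real.rpow_one]; ring
    simp only [Function.comp_apply]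
    rw [e1, e2, Real.exp_nat_mul]
    gcongr
    linarith [Real.add_one_le_exp (-(c / rate α n))]

/-- The normalizing powers `(1 + g / n ^ α) ^ n` grow at different speeds for different `g`. -/
lemma tendsto_sq_mul_div_pow {α : ℝ} (hα : α ∈ Set.Ioo (0 : ℝ) 1) {g h : ℝ} (hh : 0 ≤ h)
    (hgh : h < g) :
    Tendsto (fun n : ℕ => (n : ℝ) ^ 2 * ((1 + h / rate α n) / (1 + g / rate α n)) ^ n) atTop
      (𝓝 0) := by
  refine tendsto_sq_mul_pow_of_le hα (c := (g - h) / 2) (by linarith) ?_ ?_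
  · refine Eventually.of_forall fun n => ?_
    have h1 := one_le_one_add_div_rate α hh n
    have h2 := one_le_one_add_div_rate α (hh.trans hgh.le) n
    positivity
  · filter_upwards [(tendsto_rate hα.1).eventually_ge_atTop (max g 1)] with n hn
    have hk1 : 1 ≤ rate α n := (le_max_right _ _).trans hn
    have hkg : g ≤ rate α n := (le_max_left _ _).trans hn
    have hk : 0 < rate α n := by linarith
    have h2 := one_le_one_add_div_rate α (hh.trans hgh.le) n
    have h3 : g / rate α n ≤ 1 := (div_le_one hk).2 hkg
    rw [div_le_iff₀ (by linarith)]
    have e : (g - h) / 2 / rate α n = (g / rate α n - h / rate α n) / 2 := by ring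
    have h4 : h / rate α n ≤ g / rate α n := by gcongr
    rw [e]
    nlinarith

lemma tendsto_sq_mul_inv_pow {α : ℝ} (hα : α ∈ Set.Ioo (0 : ℝ) 1) {g : ℝ} (hg : 0 < g) :
    Tendsto (fun n : ℕ => (n : ℝ) ^ 2 * ((1 + g / rate α n)⁻¹) ^ n) atTop (𝓝 0) := by
  simpa using tendsto_sq_mul_div_pow hα le_rfl hg

lemma tendsto_inv_pow {α : ℝ} (hα : α ∈ Set.Ioo (0 : ℝ) 1) {g : ℝ} (hg : 0 < g) :
    Tendsto (fun n : ℕ => ((1 + g / rate α n)⁻¹) ^ n) atTop (𝓝 0) := by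
  refine squeeze_zero' (Eventually.of_forall fun n => ?_) ?_ (tendsto_sq_mul_inv_pow hα hg)
  · have := one_le_one_add_div_rate α hg.le n
    positivity
  · filter_upwards [eventually_ge_atTop 1] with n hn
    have := one_le_one_add_div_rate α hg.le n
    have h1 : (1 : ℝ) ≤ (n : ℝ) ^ 2 := one_le_pow₀ (by exact_mod_cast hn)
    exact le_mul_of_one_le_left (by positivity) h1

lemma sum_Icc_pow_div_pow {z : ℝ} (hz : z ≠ 0) (hz1 : z ≠ 1) (n : ℕ) :
    (∑ k ∈ Finset.Icc 1 n, z ^ k) / z ^ n = (1 - z⁻¹ ^ n) / (1 - z⁻¹) := by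
  have h1 : 1 - z⁻¹ ≠ 0 := by
    rw [sub_ne_zero]; intro h; exact hz1 (inv_eq_one.1 h.symm)
  rw [div_eq_div_iff (pow_ne_zero n hz) h1]
  induction n with
  | zero => simp
  | succ n ih =>
    rw [Finset.sum_Icc_succ_top (by omega), add_mul, ih]
    rw [inv_pow, inv_pow]
    field_simp
    ring

lemma sum_range_pow_succ {q : ℝ} (hq1 : q ≠ 1) (n : ℕ) :
    ∑ i ∈ Finset.range n, q ^ (i + 1) = q * ((1 - q ^ n) / (1 - q)) := by
  simp_rw [pow_succ']
  rw [← Finset.mul_sum, geom_sum_eq hq1, ← neg_div_neg_eq, neg_sub, neg_sub]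

/-- The geometric series `∑ x^{-2k}`, `x = 1 + g / n ^ α`, is of order `n ^ α / (2 g)`. -/
lemma tendsto_geometric {α : ℝ} (hα : α ∈ Set.Ioo (0 : ℝ) 1) {g : ℝ} (hg : 0 < g) :
    Tendsto (fun n : ℕ => (1 - (((1 + g / rate α n) ^ 2)⁻¹) ^ n)
      / (1 - ((1 + g / rate α n) ^ 2)⁻¹) / rate α n) atTop (𝓝 (1 / (2 * g))) := by
  have hx := tendsto_one_add_div_rate hα.1 g
  have h1 : Tendsto (fun n : ℕ => (1 - (((1 + g / rate α n)⁻¹) ^ n) ^ 2)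
      * (1 + g / rate α n) ^ 2 / (2 * g + g * (g / rate α n))) atTop
      (𝓝 ((1 - 0 ^ 2) * 1 ^ 2 / (2 * g + g * 0))) := by
    refine Tendsto.div ?_ ?_ (by positivity)
    · exact (((tendsto_inv_pow hα hg).pow 2).const_sub 1).mul (hx.pow 2)
    · exact ((tendsto_const_div_rate hα.1 g).const_mul g).const_add _
  have e : (1 - (0 : ℝ) ^ 2) * 1 ^ 2 / (2 * g + g * 0) = 1 / (2 * g) := by norm_num
  rw [e] at h1
  refine h1.congr' ?_
  filter_upwards [(tendsto_rate hα.1).eventually_gt_atTop 0] with n hk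
  have hx1 : 0 < 1 + g / rate α n := by positivity
  set x := 1 + g / rate α n with hxdef
  have hg' : 2 * g + g * (g / rate α n) = (x ^ 2 - 1) * rate α n := by
    rw [hxdef]; field_simp; ring
  have hx2 : x ^ 2 - 1 ≠ 0 := by
    intro h0
    rw [h0, zero_mul] at hg'
    have : 0 < 2 * g + g * (g / rate α n) := by positivity
    linarith
  have e2 : ((x ^ 2)⁻¹) ^ n = (x⁻¹ ^ n) ^ 2 := by rw [← inv_pow, ← pow_mul, ← pow_mul, mul_comm]
  have e3 : 1 - (x ^ 2)⁻¹ = (x ^ 2 - 1) / x ^ 2 := by field_simp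
  rw [hg', e2, e3]
  field_simp

lemma tendsto_sum_inv_pow_sq {α : ℝ} (hα : α ∈ Set.Ioo (0 : ℝ) 1) {g : ℝ} (hg : 0 < g) :
    Tendsto (fun n : ℕ => (∑ i ∈ Finset.range n, ((1 + g / rate α n)⁻¹ ^ (i + 1)) ^ 2) / rate α n)
      atTop (𝓝 (1 / (2 * g))) := by
  have h1 := (((tendsto_one_add_div_rate hα.1 g).pow 2).inv₀ (by norm_num)).mul
    (tendsto_geometric hα hg)
  simp only [one_pow, inv_one, one_mul] at h1
  refine h1.congr' ?_
  filter_upwards [(tendsto_rate hα.1).eventually_gt_atTop 0] with n hk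
  have hx1 : 1 < 1 + g / rate α n := by
    have : 0 < g / rate α n := by positivity
    linarith
  have e : ∀ i, ((1 + g / rate α n)⁻¹ ^ (i + 1)) ^ 2 = ((1 + g / rate α n) ^ 2)⁻¹ ^ (i + 1) :=
    fun i => by rw [← inv_pow, ← pow_mul, ← pow_mul, mul_comm]
  simp_rw [e]
  rw [sum_range_pow_succ, mul_div_assoc]
  exact (inv_lt_one_of_one_lt₀ (one_lt_pow₀ hx1 two_ne_zero)).ne

/-- Alternating geometric sums stay bounded; this makes the two discounted sums asymptotically
uncorrelated. -/
lemma tendsto_sum_alternating {α : ℝ} (hα : α ∈ Set.Ioo (0 : ℝ) 1) {z : ℕ → ℝ}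
    (hz : ∀ n, z n ≤ -1) :
    Tendsto (fun n : ℕ => (∑ i ∈ Finset.range n, (z n)⁻¹ ^ (i + 1)) / rate α n) atTop (𝓝 0) := by
  refine squeeze_zero_norm (a := fun n => 2 / rate α n) (fun n => ?_) (tendsto_const_div_rate hα.1 2)
  have hz1 : |(z n)⁻¹| ≤ 1 := by
    rw [abs_inv]; exact inv_le_one_of_one_le₀ (by rw [le_abs]; right; linarith [hz n])
  have hz0 : (z n)⁻¹ ≤ 0 := inv_nonpos.2 (by linarith [hz n])
  rw [sum_range_pow_succ (by linarith), norm_div, Real.norm_of_nonneg (rate_nonneg α n)]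
  gcongr
  · exact rate_nonneg α n
  rw [Real.norm_eq_abs, abs_mul, abs_div, abs_of_nonneg (show 0 ≤ 1 - (z n)⁻¹ by linarith)]
  have h1 : |1 - (z n)⁻¹ ^ n| ≤ 2 := by
    refine (abs_sub _ _).trans ?_
    rw [abs_one, abs_pow]
    linarith [pow_le_one₀ (n := n) (abs_nonneg _) hz1]
  have h2 : |1 - (z n)⁻¹ ^ n| / (1 - (z n)⁻¹) ≤ 2 := by
    rw [div_le_iff₀ (by linarith)]; nlinarith
  calc |(z n)⁻¹| * (|1 - (z n)⁻¹ ^ n| / (1 - (z n)⁻¹)) ≤ 1 * 2 := by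
        gcongr
        exact div_nonneg (abs_nonneg _) (by linarith)
    _ = 2 := one_mul 2

/-- When the ratio tends to `-1`, the geometric sum is about half of its last term, whereas for a positive
ratio near `1` it is a large multiple of it. -/
lemma tendsto_sum_Icc_alternating {z : ℕ → ℝ} (hz : Tendsto z atTop (𝓝 (-1)))
    (hzn : Tendsto (fun n => (z n)⁻¹ ^ n) atTop (𝓝 0)) :
    Tendsto (fun n : ℕ => (∑ k ∈ Finset.Icc 1 n, z n ^ k) / z n ^ n) atTop (𝓝 (1 / 2)) := by
  have h := (hzn.const_sub 1).div ((hz.inv₀ (by norm_num)).const_sub 1) (by norm_num)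
  norm_num at h
  refine (h.congr' ?_)
  filter_upwards [hz.eventually (gt_mem_nhds (show (-1 : ℝ) < 0 by norm_num))] with n hn
  rw [sum_Icc_pow_div_pow hn.ne (by linarith)]
  simp

end Asymptotics

/-! ### Joint limit of the discounted sums -/

lemma tendstoInMeasure_pair {Ω : Type*} [MeasurableSpace Ω] {P : Measure Ω}
    {F G : ℕ → Ω → ℝ} {c d : ℕ → ℝ} (hF : ∀ n, LpBounded P 1 (F n) (c n))
    (hG : ∀ n, LpBounded P 1 (G n) (d n)) (hc : Tendsto c atTop (𝓝 0))
    (hd : Tendsto d atTop (𝓝 0)) :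
    TendstoInMeasure P (fun n ω => (F n ω, G n ω)) atTop (0 : Ω → ℝ × ℝ) := by
  refine tendstoInMeasure_of_tendsto_eLpNorm one_ne_zero
    (fun n => (hF n).memLp.1.prodMk (hG n).memLp.1) aestronglyMeasurable_const ?_
  have hlim : Tendsto (fun n => ENNReal.ofReal (c n) + ENNReal.ofReal (d n)) atTop (𝓝 0) := by
    simpa using (ENNReal.tendsto_ofReal hc).add (ENNReal.tendsto_ofReal hd)
  refine tendsto_of_tendsto_of_tendsto_of_le_of_le tendsto_const_nhds hlim
    (fun n => zero_le) fun n => ?_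
  rw [sub_zero]
  calc eLpNorm (fun ω => (F n ω, G n ω)) 1 P
      ≤ eLpNorm ((fun ω => ‖F n ω‖) + fun ω => ‖G n ω‖) 1 P := by
        refine eLpNorm_mono_real fun ω => ?_
        simp only [Pi.add_apply, Prod.norm_def]
        exact max_le (le_add_of_nonneg_right (norm_nonneg _))
          (le_add_of_nonneg_left (norm_nonneg _))
    _ ≤ eLpNorm (fun ω => ‖F n ω‖) 1 P + eLpNorm (fun ω => ‖G n ω‖) 1 P :=
        eLpNorm_add_le (hF n).memLp.1.norm (hG n).memLp.1.norm le_rfl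
    _ ≤ _ := by
        rw [eLpNorm_norm, eLpNorm_norm]
        exact add_le_add (hF n).le (hG n).le

lemma aemeasurable_arError {Ω : Type*} [MeasurableSpace Ω] {P : Measure Ω} {V : ℕ → Ω → ℝ}
    (hV : ∀ i, AEMeasurable (V (i + 1)) P) (r : ℝ) (k : ℕ) : AEMeasurable (arError r V k) P := by
  induction k with
  | zero => exact aemeasurable_const
  | succ k ih => exact (ih.const_mul r).add (hV k)

lemma aemeasurable_arObs {Ω : Type*} [MeasurableSpace Ω] {P : Measure Ω} {V : ℕ → Ω → ℝ}
    (hV : ∀ i, AEMeasurable (V (i + 1)) P) (l m : ℝ) (k : ℕ) : AEMeasurable (arObs l m V k) P := by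
  induction k with
  | zero => exact aemeasurable_const
  | succ k ih => exact (ih.const_mul l).add (aemeasurable_arError hV m (k + 1))

lemma aemeasurable_lsEstimator {Ω : Type*} [MeasurableSpace Ω] {P : Measure Ω} {V : ℕ → Ω → ℝ}
    (hV : ∀ i, AEMeasurable (V (i + 1)) P) (l m : ℝ) (n : ℕ) :
    AEMeasurable (fun ω => lsEstimator (fun k => arObs l m V k ω) n) P := by
  have h := aemeasurable_arObs hV l m
  unfold lsEstimator
  exact (Finset.aemeasurable_fun_sum _ fun k _ => (h k).mul (h (k - 1))).div
    (Finset.aemeasurable_fun_sum _ fun k _ => (h (k - 1)).pow_const 2)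

/-- The weights of the normalized discounted sum `√(2 g / n ^ α) * discountedSum (s * x) V n`,
where `x = 1 + g / n ^ α`; the factor `t` is a further sign. -/
noncomputable def discountWeight (α g s t : ℝ) (n i : ℕ) : ℝ :=
  t * √(2 * g / rate α n) * (s * (1 + g / rate α n))⁻¹ ^ (i + 1)

lemma sum_discountWeight {Ω : Type*} (α g s t : ℝ) (V : ℕ → Ω → ℝ) (n : ℕ) (ω : Ω) :
    ∑ i ∈ Finset.range n, discountWeight α g s t n i * V (i + 1) ω
      = t * √(2 * g / rate α n) * discountedSum (s * (1 + g / rate α n)) V n ω := by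
  rw [discountedSum, Finset.mul_sum]
  exact Finset.sum_congr rfl fun i _ => by rw [discountWeight]; ring

lemma abs_discountWeight_le {α g s t : ℝ} (hg : 0 ≤ g) (hs : |s| = 1) (ht : |t| = 1) (n i : ℕ) :
    |discountWeight α g s t n i| ≤ √(2 * g / rate α n) := by
  have hx := one_le_one_add_div_rate α hg n
  rw [discountWeight, abs_mul, abs_mul, ht, one_mul, abs_of_nonneg (Real.sqrt_nonneg _), abs_pow,
    abs_inv, abs_mul, hs, one_mul]
  refine mul_le_of_le_one_right (Real.sqrt_nonneg _) (pow_le_one₀ (by positivity) ?_)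
  exact inv_le_one_of_one_le₀ (hx.trans (le_abs_self _))

lemma tendsto_sum_discountWeight_sq {α g s t : ℝ} (hα : α ∈ Set.Ioo (0 : ℝ) 1) (hg : 0 < g)
    (hs : s ^ 2 = 1) (ht : t ^ 2 = 1) :
    Tendsto (fun n => ∑ i ∈ Finset.range n, discountWeight α g s t n i ^ 2) atTop (𝓝 1) := by
  have h := (tendsto_sum_inv_pow_sq hα hg).const_mul (2 * g)
  rw [mul_one_div_cancel (by positivity)] at h
  refine h.congr fun n => ?_
  rw [← mul_div_assoc, mul_div_right_comm, Finset.mul_sum]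
  refine Finset.sum_congr rfl fun i _ => ?_
  have h1 : 0 ≤ 2 * g / rate α n := div_nonneg (by positivity) (rate_nonneg α n)
  have h2 : s⁻¹ ^ 2 = 1 := by rw [inv_pow, hs, inv_one]
  rw [discountWeight, mul_inv, mul_pow, mul_pow, mul_pow, Real.sq_sqrt h1, ht, mul_pow,
    ← pow_mul, ← pow_mul, mul_comm (i + 1) 2, pow_mul, pow_mul, h2]
  ring

lemma tendsto_sum_discountWeight_mul {α g h s t : ℝ} (hα : α ∈ Set.Ioo (0 : ℝ) 1) (hg : 0 < g)
    (hh : 0 < h) (hs : s ^ 2 = 1) :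
    Tendsto (fun n => ∑ i ∈ Finset.range n,
      discountWeight α g s 1 n i * discountWeight α h (-s) t n i) atTop (𝓝 0) := by
  have h1 := (tendsto_sum_alternating hα
    (z := fun n => -((1 + g / rate α n) * (1 + h / rate α n))) fun n => by
      have := one_le_one_add_div_rate α hg.le n
      have := one_le_one_add_div_rate α hh.le n
      nlinarith).const_mul (t * (√(2 * g) * √(2 * h)))
  rw [mul_zero] at h1
  refine h1.congr' ?_
  filter_upwards with n
  have hk := rate_nonneg α n
  rw [← mul_div_assoc, mul_div_right_comm, Finset.mul_sum]
  refine Finset.sum_congr rfl fun i _ => ?_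
  have e1 : √(2 * g / rate α n) * √(2 * h / rate α n) = √(2 * g) * √(2 * h) / rate α n := by
    rw [Real.sqrt_div (by positivity), Real.sqrt_div (by positivity), div_mul_div_comm,
      Real.mul_self_sqrt hk]
  have e2 : (-((1 + g / rate α n) * (1 + h / rate α n)))
      = (s * (1 + g / rate α n)) * (-s * (1 + h / rate α n)) := by
    linear_combination ((1 + g / rate α n) * (1 + h / rate α n)) * hs
  have e3 : discountWeight α g s 1 n i * discountWeight α h (-s) t n i
      = t * (√(2 * g / rate α n) * √(2 * h / rate α n))
        * ((s * (1 + g / rate α n)) * (-s * (1 + h / rate α n)))⁻¹ ^ (i + 1) := by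
    rw [discountWeight, discountWeight, mul_inv (s * (1 + g / rate α n)), mul_pow (s * _)⁻¹]
    ring
  rw [e3, e1, e2]
  ring

/-- The normalized discounted sums are asymptotically a standard Gaussian pair. -/
lemma tendstoInDistribution_discountedSum {Ω : Type*} [MeasurableSpace Ω] {P : Measure Ω}
    [IsProbabilityMeasure P] {V : ℕ → Ω → ℝ}
    (hindep : iIndepFun (fun k : ℕ => V (k + 1)) P)
    (hident : ∀ k : ℕ, IdentDistrib (V (k + 1)) (V 1) P P) (h0 : P[V 1] = 0) (h1 : P[V 1 ^ 2] = 1)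
    {α g h s : ℝ} (hα : α ∈ Set.Ioo (0 : ℝ) 1) (hg : 0 < g) (hh : 0 < h) (hs : s ^ 2 = 1) :
    TendstoInDistribution
      (fun (n : ℕ) ω => (∑ i ∈ Finset.range n, discountWeight α g s 1 n i * V (i + 1) ω,
        ∑ i ∈ Finset.range n, discountWeight α h (-s) s n i * V (i + 1) ω))
      atTop (id : ℝ × ℝ → ℝ × ℝ) (fun _ => P) ((gaussianReal 0 1).prod (gaussianReal 0 1)) := by
  have hs' : |s| = 1 :=
    (sq_eq_sq₀ (abs_nonneg s) zero_le_one).1 (by rw [sq_abs, hs, one_pow])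
  have hsqrt : ∀ g : ℝ, Tendsto (fun n => √(2 * g / rate α n)) atTop (𝓝 0) := fun g => by
    simpa using (tendsto_const_div_rate hα.1 (2 * g)).sqrt
  refine tendstoInDistribution_weighted_pair (U := fun k => V (k + 1)) hindep hident h0 h1
    (δ := fun n => √(2 * g / rate α n) + √(2 * h / rate α n))
    (by simpa using (hsqrt g).add (hsqrt h)) ?_ ?_
    (tendsto_sum_discountWeight_sq hα hg hs (one_pow 2))
    (tendsto_sum_discountWeight_sq hα hh (by rw [neg_sq, hs]) hs)
    (tendsto_sum_discountWeight_mul hα hg hh hs)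
  · exact Eventually.of_forall fun n i _ => (abs_discountWeight_le hg.le hs' abs_one n i).trans
      (le_add_of_nonneg_right (Real.sqrt_nonneg _))
  · exact Eventually.of_forall fun n i _ =>
      (abs_discountWeight_le hh.le (by rwa [abs_neg]) hs' n i).trans
      (le_add_of_nonneg_left (Real.sqrt_nonneg _))

/-! ### The estimation error -/

/-- The estimation error for innovations of unit variance, when `l` is the dominant root. The sign
`s` allows the dominant root to be positive or negative. -/
lemma tendstoInDistribution_dominant_root_of_unit_variance {Ω Ω' : Type*} [MeasurableSpace Ω]
    [MeasurableSpace Ω'] {P : Measure Ω} [IsProbabilityMeasure P] {P' : Measure Ω'}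
    [IsProbabilityMeasure P'] {V : ℕ → Ω → ℝ}
    (hindep : iIndepFun (fun k : ℕ => V (k + 1)) P)
    (hident : ∀ k : ℕ, IdentDistrib (V (k + 1)) (V 1) P P) (hL2 : MemLp (V 1) 2 P)
    (h0 : P[V 1] = 0) (h1 : P[V 1 ^ 2] = 1)
    {α g h s : ℝ} (hα : α ∈ Set.Ioo (0 : ℝ) 1) (hh : 0 < h) (hgh : h < g) (hs : s ^ 2 = 1)
    {l m : ℕ → ℝ} (hl : ∀ n, l n = s * (1 + g / rate α n))
    (hm : ∀ n, m n = -s * (1 + h / rate α n))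
    {C : Ω' → ℝ} (hC : HasLaw C (cauchyMeasure 0 1) P') :
    TendstoInDistribution
      (fun (n : ℕ) (ω : Ω) => 1 / (2 * g) * √(h / g) * rate α n * l n ^ n * m n ^ (-(n : ℤ))
        * (lsEstimator (fun k => arObs (l n) (m n) V k ω) n - l n))
      atTop C (fun _ => P) P' := by
  have hg : 0 < g := hh.trans hgh
  have hs' : |s| = 1 := (sq_eq_sq₀ (abs_nonneg s) zero_le_one).1 (by rw [sq_abs, hs, one_pow])
  have hVm i : AEMeasurable (V (i + 1)) P := (hident i).aemeasurable_fst
  set x : ℕ → ℝ := fun n => 1 + g / rate α n with hx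
  set y : ℕ → ℝ := fun n => 1 + h / rate α n with hy
  have hx1 n : 1 ≤ x n := one_le_one_add_div_rate α hg.le n
  have hy1 n : 1 ≤ y n := one_le_one_add_div_rate α hh.le n
  have hyx n : y n ≤ x n := by
    have := div_le_div_of_nonneg_right hgh.le (rate_nonneg α n)
    simp only [hx, hy]; linarith
  have hlabs n : |l n| = x n := by
    rw [hl, abs_mul, hs', one_mul]; exact abs_of_nonneg (zero_le_one.trans (hx1 n))
  have hmabs n : |m n| = y n := by
    rw [hm, abs_mul, abs_neg, hs', one_mul]; exact abs_of_nonneg (zero_le_one.trans (hy1 n))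
  have hl0 n : l n ≠ 0 := abs_pos.1 (by rw [hlabs]; linarith [hx1 n])
  have hm0 n : m n ≠ 0 := abs_pos.1 (by rw [hmabs]; linarith [hy1 n])
  have hlsq n : l n ^ 2 = x n ^ 2 := by rw [← sq_abs, hlabs]
  have hlm n : l n * m n = -(x n * y n) := by
    rw [hl, hm]; linear_combination -(x n * y n) * hs
  have hsub n : l n - m n = s * (x n + y n) := by rw [hl, hm]; ring
  have hne n : l n ≠ m n := by
    rw [← sub_ne_zero, hsub]
    have hs0 : s ≠ 0 := by rintro rfl; norm_num at hs
    exact mul_ne_zero hs0 (by linarith [hx1 n, hy1 n])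
  have hLp : ∀ (c : ℕ → ℝ) (t : Finset ℕ),
      LpBounded P 2 (fun ω => ∑ i ∈ t, c i * V (i + 1) ω) (√(∑ i ∈ t, c i ^ 2)) :=
    lpBounded_weighted_sum (U := fun k => V (k + 1)) hindep hident hL2 h0 h1
  -- The normalized discounted sums; `b` carries the sign `s`, which cancels that of `l - m ≈ 2 s`.
  set a : ℕ → Ω → ℝ := fun n ω => ∑ i ∈ Finset.range n, discountWeight α g s 1 n i * V (i + 1) ω
    with ha
  set b : ℕ → Ω → ℝ := fun n ω =>
    ∑ i ∈ Finset.range n, discountWeight α h (-s) s n i * V (i + 1) ω with hb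
  have hab := tendstoInDistribution_discountedSum hindep hident h0 h1 hα hg hh hs
  have haS n ω : a n ω = √(2 * g / rate α n) * discountedSum (l n) V n ω := by
    rw [ha, hl]; simp only [sum_discountWeight, one_mul]
  have hbS n ω : b n ω = s * √(2 * h / rate α n) * discountedSum (m n) V n ω := by
    rw [hb, hm]; simp only [sum_discountWeight]
  have hapar n : LpBounded P 2 (a n) (√(∑ i ∈ Finset.range n, discountWeight α g s 1 n i ^ 2)) :=
    hLp _ _
  have hbpar n : LpBounded P 2 (b n) (√(∑ i ∈ Finset.range n, discountWeight α h (-s) s n i ^ 2)) :=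
    hLp _ _
  have hAlim := (tendsto_sum_discountWeight_sq (t := 1) hα hg hs (one_pow 2)).sqrt
  have hBlim := (tendsto_sum_discountWeight_sq (s := -s) (t := s) hα hh
    (by rw [neg_sq, hs]) hs).sqrt
  -- `cN * N` and `cD * D` are the normalized numerator and denominator of the estimation error: the
  -- constants are such that these are asymptotic to `a * b` and `a * a`, where `pN` and `pD` are
  -- the relative errors of the geometric sums.
  set N : ℕ → Ω → ℝ := fun n ω => ∑ k ∈ Finset.Icc 1 n,
    arError (m n) V k ω * (arError (l n) V k ω - arError (m n) V k ω) with hN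
  set D : ℕ → Ω → ℝ := fun n ω => ∑ k ∈ Finset.Icc 1 n,
    (arError (l n) V k ω - arError (m n) V k ω) ^ 2 with hD
  set cN : ℕ → ℝ := fun n => 2 * √(g * h) * (l n - m n) / (rate α n * (l n * m n) ^ n) with hcN
  set cD : ℕ → ℝ := fun n => 4 * g ^ 2 / (rate α n ^ 2 * (l n ^ 2) ^ n) with hcD
  set pN : ℕ → ℝ := fun n => s * (l n - m n)
    * ((∑ k ∈ Finset.Icc 1 n, (l n * m n) ^ k) / (l n * m n) ^ n) - 1 with hpN
  set pD : ℕ → ℝ := fun n => 2 * g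
    * ((∑ k ∈ Finset.Icc 1 n, (l n ^ 2) ^ k) / (l n ^ 2) ^ n / rate α n) - 1 with hpD
  have hxlim : Tendsto x atTop (𝓝 1) := tendsto_one_add_div_rate hα.1 g
  have hylim : Tendsto y atTop (𝓝 1) := tendsto_one_add_div_rate hα.1 h
  have hklim := tendsto_rate hα.1
  have hsqrt_mul n : √(2 * g / rate α n) * √(2 * h / rate α n) = 2 * √(g * h) / rate α n := by
    have hk := rate_nonneg α n
    rw [← Real.sqrt_mul (by positivity)]
    have e : 2 * g / rate α n * (2 * h / rate α n) = (2 / rate α n) ^ 2 * (g * h) := by ring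
    rw [e, Real.sqrt_mul (by positivity), Real.sqrt_sq (by positivity)]
    ring
  have hpNlim : Tendsto pN atTop (𝓝 0) := by
    have hz : Tendsto (fun n => l n * m n) atTop (𝓝 (-1)) := by
      simp_rw [hlm]
      simpa using (hxlim.mul hylim).neg
    have hzn : Tendsto (fun n => (l n * m n)⁻¹ ^ n) atTop (𝓝 0) := by
      have h2 := (tendsto_inv_pow hα hg).mul (tendsto_inv_pow hα hh)
      rw [mul_zero] at h2
      refine squeeze_zero_norm (fun n => le_of_eq ?_) h2
      rw [norm_pow, norm_inv, Real.norm_eq_abs, abs_mul, hlabs, hmabs, mul_inv, mul_pow]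
    have h2 := (((hxlim.add hylim).mul (tendsto_sum_Icc_alternating hz hzn)).sub_const 1)
    have e : ((1 : ℝ) + 1) * (1 / 2) - 1 = 0 := by norm_num
    rw [e] at h2
    refine h2.congr fun n => ?_
    have e2 : s * (l n - m n) = x n + y n := by
      rw [hsub]; linear_combination (x n + y n) * hs
    simp only [hpN]
    rw [e2]
  have hpDlim : Tendsto pD atTop (𝓝 0) := by
    have h2 := ((tendsto_geometric hα hg).const_mul (2 * g)).sub_const 1
    rw [mul_one_div_cancel (by positivity), sub_self] at h2
    refine h2.congr' ?_
    filter_upwards [hklim.eventually_gt_atTop 0] with n hk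
    have hx2 : 1 < x n := by
      have : 0 < g / rate α n := by positivity
      simp only [hx]; linarith
    simp only [hpD]
    rw [hlsq, sum_Icc_pow_div_pow (pow_ne_zero 2 (by linarith)) (one_lt_pow₀ hx2 two_ne_zero).ne']
  have hNdiff n : LpBounded P 1 (fun ω => cN n * N n ω - a n ω * b n ω)
      (|cN n| * ((n : ℝ) ^ 2 * (3 * x n ^ n + (y n ^ n) ^ 2))
        + |pN n| * (√(∑ i ∈ Finset.range n, discountWeight α g s 1 n i ^ 2)
          * √(∑ i ∈ Finset.range n, discountWeight α h (-s) s n i ^ 2))) := by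
    have h2 := lpBounded_numerator hLp (l := l n) (m := m n) (by rw [hmabs]; exact hy1 n)
      (by rw [hlabs, hmabs]; exact hyx n) n
    rw [hlabs, hmabs] at h2
    have h3 := (h2.const_mul (cN n)).add le_rfl (((hapar n).mul (hbpar n)).const_mul (pN n))
    convert! h3 using 2 with ω
    have e : a n ω * b n ω
        = s * (2 * √(g * h) / rate α n) * (discountedSum (l n) V n ω * discountedSum (m n) V n ω) := by
      rw [haS, hbS, ← hsqrt_mul]; ring
    rw [e]
    simp only [hN, hcN, hpN]
    linear_combination -(2 * √(g * h) / rate α n * (l n - m n)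
      * ((∑ k ∈ Finset.Icc 1 n, (l n * m n) ^ k) / (l n * m n) ^ n)
      * (discountedSum (l n) V n ω * discountedSum (m n) V n ω)) * hs
  have hDdiff n : LpBounded P 1 (fun ω => cD n * D n ω - a n ω * a n ω)
      (|cD n| * ((n : ℝ) ^ 2 * (8 * (x n ^ n * y n ^ n)))
        + |pD n| * (√(∑ i ∈ Finset.range n, discountWeight α g s 1 n i ^ 2)
          * √(∑ i ∈ Finset.range n, discountWeight α g s 1 n i ^ 2))) := by
    have h2 := lpBounded_denominator hLp (l := l n) (m := m n) (by rw [hmabs]; exact hy1 n)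
      (by rw [hlabs, hmabs]; exact hyx n) n
    rw [hlabs, hmabs] at h2
    have h3 := (h2.const_mul (cD n)).add le_rfl (((hapar n).mul (hapar n)).const_mul (pD n))
    convert! h3 using 2 with ω
    have e : a n ω * a n ω = 2 * g / rate α n * discountedSum (l n) V n ω ^ 2 := by
      have hk : 0 ≤ 2 * g / rate α n := div_nonneg (by positivity) (rate_nonneg α n)
      rw [haS, ← pow_two, mul_pow, Real.sq_sqrt hk]
    rw [e]
    simp only [hD, hcD, hpD]
    ring
  have hNlim : Tendsto (fun n : ℕ => |cN n| * ((n : ℝ) ^ 2 * (3 * x n ^ n + (y n ^ n) ^ 2))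
        + |pN n| * (√(∑ i ∈ Finset.range n, discountWeight α g s 1 n i ^ 2)
          * √(∑ i ∈ Finset.range n, discountWeight α h (-s) s n i ^ 2))) atTop (𝓝 0) := by
    have h2 : Tendsto (fun n : ℕ => 2 * √(g * h) * (x n + y n) * (1 / rate α n)
        * (3 * ((n : ℝ) ^ 2 * (y n)⁻¹ ^ n) + (n : ℝ) ^ 2 * (y n / x n) ^ n)) atTop
        (𝓝 (2 * √(g * h) * (1 + 1) * 0 * (3 * 0 + 0))) :=
      (((hxlim.add hylim).const_mul _).mul (tendsto_const_div_rate hα.1 1)).mul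
        (((tendsto_sq_mul_inv_pow hα hh).const_mul 3).add (tendsto_sq_mul_div_pow hα hh.le hgh))
    have h3 := h2.add (hpNlim.abs.mul (hAlim.mul hBlim))
    simp only [mul_zero, add_zero, abs_zero, zero_mul] at h3
    refine h3.congr fun n => ?_
    congr 1
    have hx0 : x n ≠ 0 := by linarith [hx1 n]
    have hy0 : y n ≠ 0 := by linarith [hy1 n]
    have e : |cN n| = 2 * √(g * h) * (x n + y n) / (rate α n * (x n * y n) ^ n) := by
      simp only [hcN]
      rw [abs_div, abs_mul, abs_mul, abs_mul, abs_pow, abs_mul (l n), hlabs, hmabs, hsub, abs_mul,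
        hs', abs_of_nonneg (rate_nonneg α n), abs_of_nonneg (Real.sqrt_nonneg _), abs_two, one_mul,
        abs_of_nonneg (by linarith [hx1 n, hy1 n])]
    rw [e, mul_pow, div_pow, inv_pow]
    by_cases hk : rate α n = 0
    · simp [hk]
    field_simp
  have hDlim : Tendsto (fun n : ℕ => |cD n| * ((n : ℝ) ^ 2 * (8 * (x n ^ n * y n ^ n)))
        + |pD n| * (√(∑ i ∈ Finset.range n, discountWeight α g s 1 n i ^ 2)
          * √(∑ i ∈ Finset.range n, discountWeight α g s 1 n i ^ 2))) atTop (𝓝 0) := by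
    have h2 : Tendsto (fun n : ℕ => 32 * g ^ 2 * (1 / rate α n) ^ 2
        * ((n : ℝ) ^ 2 * (y n / x n) ^ n)) atTop (𝓝 (32 * g ^ 2 * 0 ^ 2 * 0)) :=
      (((tendsto_const_div_rate hα.1 1).pow 2).const_mul _).mul
        (tendsto_sq_mul_div_pow hα hh.le hgh)
    have h3 := h2.add (hpDlim.abs.mul (hAlim.mul hAlim))
    simp only [mul_zero, add_zero, abs_zero, zero_mul] at h3
    refine h3.congr fun n => ?_
    congr 1
    have hx0 : x n ≠ 0 := by linarith [hx1 n]
    have e : |cD n| = 4 * g ^ 2 / (rate α n ^ 2 * (x n ^ 2) ^ n) := by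
      simp only [hcD]
      rw [hlsq, abs_of_nonneg (by positivity)]
    rw [e, div_pow (y n), ← pow_mul, mul_comm 2 n, pow_mul]
    by_cases hk : rate α n = 0
    · simp [hk]
    have hxn : x n ^ n ≠ 0 := pow_ne_zero n hx0
    generalize x n ^ n = X at hxn ⊢
    field_simp
    ring
  have hmeasure := tendstoInMeasure_pair hNdiff hDdiff hNlim hDlim
  have hprod := hab.continuous_comp (g := fun p : ℝ × ℝ => (p.1 * p.2, p.1 * p.1)) (by fun_prop)
  have hND : TendstoInDistribution (fun n ω => (cN n * N n ω, cD n * D n ω)) atTop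
      ((fun p : ℝ × ℝ => (p.1 * p.2, p.1 * p.1)) ∘ id) (fun _ => P)
      ((gaussianReal 0 1).prod (gaussianReal 0 1)) := by
    refine tendstoInDistribution_of_tendstoInMeasure_sub _ _ hprod hmeasure fun n => ?_
    have hA := aemeasurable_arError hVm (l n)
    have hB := aemeasurable_arError hVm (m n)
    refine AEMeasurable.prodMk (AEMeasurable.const_mul ?_ _) (AEMeasurable.const_mul ?_ _)
    · exact Finset.aemeasurable_fun_sum _ fun k _ => (hB k).mul ((hA k).sub (hB k))
    · exact Finset.aemeasurable_fun_sum _ fun k _ => ((hA k).sub (hB k)).pow_const 2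
  have hne0 : ∀ᵐ p ∂((gaussianReal 0 1).prod (gaussianReal 0 1)), p.1 ≠ 0 := by
    have h2 : ∀ᵐ z ∂(gaussianReal 0 1), z ≠ 0 :=
      (gaussianReal_absolutelyContinuous 0 one_ne_zero).ae_le (Measure.ae_ne volume 0)
    exact Measure.quasiMeasurePreserving_fst.ae h2
  refine tendstoInDistribution_div hND ?_ (fun n => ?_) ?_ hC.aemeasurable ?_
  · filter_upwards [hne0] with p hp
    exact mul_self_ne_zero.2 hp
  · exact ((aemeasurable_lsEstimator hVm (l n) (m n) n).sub_const (l n)).const_mul _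
  · -- The formula for the estimation error is needed only where the denominator does not vanish.
    filter_upwards [hklim.eventually_gt_atTop 0] with n hk ω hω
    have hD0 : D n ω ≠ 0 := right_ne_zero_of_mul hω
    rw [lsEstimator_sub (hne n) V n ω hD0]
    have e : √(h / g) = √(g * h) / g := by
      rw [show h / g = g * h / g ^ 2 by field_simp, Real.sqrt_div (by positivity),
        Real.sqrt_sq hg.le]
    change _ * ((l n - m n) * N n ω / D n ω) = cN n * N n ω / (cD n * D n ω)
    have hl0' := hl0 n
    have hm0' := hm0 n
    rw [e, zpow_neg, zpow_natCast]
    simp only [hcN, hcD]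
    rw [mul_pow, ← pow_mul, mul_comm 2 n, pow_mul]
    field_simp
    ring
  · -- `(u v) / (u u) = v / u` for a Gaussian pair `(u, v)`.
    rw [hC.map_eq, ← map_div_gaussianReal_prod]
    refine Measure.map_congr ?_
    filter_upwards [hne0] with p hp
    simp only [Function.comp_apply, id]
    field_simp

/-- The estimation error for innovations of arbitrary positive variance, when `l` is the dominant
root. The estimator does not change when the innovations are rescaled. -/
lemma tendstoInDistribution_dominant_root {Ω Ω' : Type*} [MeasurableSpace Ω]
    [MeasurableSpace Ω'] {P : Measure Ω} [IsProbabilityMeasure P] {P' : Measure Ω'}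
    [IsProbabilityMeasure P'] {V : ℕ → Ω → ℝ} {σ : ℝ} (hσ : 0 < σ)
    (hindep : iIndepFun (fun k : ℕ => V (k + 1)) P)
    (hident : ∀ k : ℕ, IdentDistrib (V (k + 1)) (V 1) P P) (hL2 : MemLp (V 1) 2 P)
    (hmean : P[V 1] = 0) (hvar : variance (V 1) P = σ ^ 2)
    {α g h s : ℝ} (hα : α ∈ Set.Ioo (0 : ℝ) 1) (hh : 0 < h) (hgh : h < g) (hs : s ^ 2 = 1)
    {l m : ℕ → ℝ} (hl : ∀ n, l n = s * (1 + g / rate α n))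
    (hm : ∀ n, m n = -s * (1 + h / rate α n))
    {C : Ω' → ℝ} (hC : HasLaw C (cauchyMeasure 0 1) P') :
    TendstoInDistribution
      (fun (n : ℕ) (ω : Ω) => 1 / (2 * g) * √(h / g) * rate α n * l n ^ n * m n ^ (-(n : ℤ))
        * (lsEstimator (fun k => arObs (l n) (m n) V k ω) n - l n))
      atTop C (fun _ => P) P' := by
  have key := tendstoInDistribution_dominant_root_of_unit_variance
    (V := fun k ω => σ⁻¹ * V k ω) (P := P)
    (hindep.comp (fun _ x => σ⁻¹ * x) fun _ => by fun_prop)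
    (fun k => (hident k).comp (u := fun x => σ⁻¹ * x) (by fun_prop))
    (hL2.const_mul σ⁻¹) (by rw [integral_const_mul, hmean, mul_zero]) (by
      rw [variance_of_integral_eq_zero hL2.aemeasurable hmean] at hvar
      simp only [Pi.pow_apply, mul_pow]
      rw [integral_const_mul, hvar, ← mul_pow, inv_mul_cancel₀ hσ.ne', one_pow])
    hα hh hgh hs hl hm hC
  simpa only [arObs_const_mul, lsEstimator_const_mul (inv_ne_zero hσ.ne')] using key

theorem theorem2
    {Ω Ω' : Type*} [MeasurableSpace Ω] [MeasurableSpace Ω']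
    (P : Measure Ω) [IsProbabilityMeasure P] (P' : Measure Ω') [IsProbabilityMeasure P']
    (V : ℕ → Ω → ℝ) (σ : ℝ) (hσ : 0 < σ)
    (hindep : iIndepFun (fun k : ℕ => V (k + 1)) P)
    (hident : ∀ k : ℕ, IdentDistrib (V (k + 1)) (V 1) P P)
    (hL2 : MemLp (V 1) 2 P)
    (hmean : ∫ ω, V 1 ω ∂P = 0)
    (hvar : variance (V 1) P = σ ^ 2)
    (α : ℝ) (hα : α ∈ Set.Ioo (0 : ℝ) 1)
    (γ₁ γ₂ : ℝ) (hγ₁ : 0 < γ₁) (hγ₂ : 0 < γ₂)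
    (C : Ω' → ℝ) (hC : HasLaw C (cauchyMeasure 0 1) P') :
    (γ₂ < γ₁ →
      TendstoInDistribution
        (fun (n : ℕ) (ω : Ω) =>
          1 / (2 * γ₁) * Real.sqrt (γ₂ / γ₁) * rate α n
            * thetaRoot α γ₁ n ^ n * rhoRoot α γ₂ n ^ (-(n : ℤ))
            * (thetaHat α γ₁ γ₂ V n ω - thetaRoot α γ₁ n))
        atTop C (fun _ => P) P') ∧
    (γ₁ < γ₂ →
      TendstoInDistribution
        (fun (n : ℕ) (ω : Ω) =>
          1 / (2 * γ₂) * Real.sqrt (γ₁ / γ₂) * rate α n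
            * rhoRoot α γ₂ n ^ n * thetaRoot α γ₁ n ^ (-(n : ℤ))
            * (thetaHat α γ₁ γ₂ V n ω - rhoRoot α γ₂ n))
        atTop C (fun _ => P) P') := by
  refine ⟨fun hγ => ?_, fun hγ => ?_⟩
  · exact tendstoInDistribution_dominant_root hσ hindep hident hL2 hmean hvar hα hγ₂ hγ
      (s := 1) (by norm_num) (fun n => by rw [thetaRoot, one_mul])
      (fun n => by rw [rhoRoot]; ring) hC
  · have key := tendstoInDistribution_dominant_root hσ hindep hident hL2 hmean hvar hα hγ₁ hγ
      (s := -1) (l := rhoRoot α γ₂) (m := thetaRoot α γ₁) (by norm_num)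
      (fun n => by rw [rhoRoot]; ring) (fun n => by rw [thetaRoot]; ring) hC
    have hne n : rhoRoot α γ₂ n ≠ thetaRoot α γ₁ n := by
      have h1 := one_le_one_add_div_rate α hγ₁.le n
      have h2 := one_le_one_add_div_rate α hγ₂.le n
      rw [rhoRoot, thetaRoot]
      intro h
      linarith
    simpa only [thetaHat, fun n k ω => arObs_comm (hne n) V k ω] using key
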